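/- **Conventions.** For a ring $R$ let $\mathrm{Mod}\,R$ be the category of right $R$-modules and, for $R$ right Noetherian, let $\mathrm{mod}\,R$ be the abelian category of finitely generated right $R$-modules. *Cleft extensions.* A cleft extension $(\mathcal B,\mathcal A,\mathsf i,\mathsf e,\mathsf l)$ of an abelian category $\mathcal B$ is an abelian category $\mathcal A$ with additive functors $\mathsf i\colon\mathcal B\to\mathcal A$, $\mathsf e\colon\mathcal A\to\mathcal B$, $\mathsf l\colon\mathcal B\to\mathcal A$ such that $\mathsf e$ is faithful and exact, $(\mathsf l,\mathsf e)$ is an adjoint pair, and $\mathsf e\mathsf i\simeq\mathrm{Id}_{\mathcal B}$. Let $\mu\colon\mathsf l\mathsf e\to\mathrm{Id}_{\mathcal A}$ be the counit, $\mathsf G(X)=\ker\mu_X$, and $\mathsf F=\mathsf e\mathsf G\mathsf i\colon\mathcal B\to\mathcal B$, a right exact endofunctor. *Perfect and nilpotent.* A right exact endofunctor $\mathsf F$ of an abelian category $\mathcal B$ with enough projectives is nilpotent if $\mathsf F^s=0$ for some $s$. It is perfect if, with $\mathbb L_i$ denoting left derived functors, (a) $\mathbb L_i\mathsf F^j(\mathsf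 F(P))=0$ for all $i,j\ge 1$ and all projective $P$; (b) there is $n\ge 0$ such that $\mathbb L_p\mathsf F^q=0$ for all $p,q\ge1$ with $p+q\ge n+1$; (c) $\mathsf F(P)$ has finite projective dimension for every projective $P$. *Gorenstein projectives.* An object $X$ of an abelian category $\mathcal A$ is Gorenstein projective if $X\cong\mathrm{Im}(P^{-1}\to P^0)$ for an acyclic complex $P^\bullet$ of projective objects such that $\mathrm{Hom}_{\mathcal A}(P^\bullet,Q)$ is acyclic for every projective $Q$. Let $\mathrm{Gproj}\,R$ be the category of Gorenstein projective objects of $\mathrm{mod}\,R$ and $\underline{\mathrm{Gproj}}\,R$ its stable category, obtained by factoring out the morphisms that factor through a projective object of $\mathrm{mod}\,R$. A two-sided Noetherian ring $R$ is CM-free if $\mathrm{Gproj}\,R=\mathrm{proj}\,R$, the category of finitely generated projective right $R$-modules. *Induced functors.* Let $\mathsf D_{\mathsf{sg}}(\mathrm{Mod}\,R)=\mathsf D^{\mathsf b}(\mathrm{Mod}\,R)/\mathsf K^{\mathsf b}(\mathrm{Proj}\,R)$ be the Verdier quotient; sending a module to its stalk complex gives a functor $\underline{\mathrm{Gproj}}\,R\to\mathsf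 D_{\mathsf{sg}}(\mathrm{Mod}\,R)$. An exact functor $\mathsf e\colon\mathrm{Mod}\,\Lambda\to\mathrm{Mod}\,\Gamma$ is said to induce a functor $\underline{\mathsf e}\colon\underline{\mathrm{Gproj}}\,\Lambda\to\underline{\mathrm{Gproj}}\,\Gamma$ if there is such a functor with $\underline{\mathsf e}(X)\cong\mathsf e(X)$ in $\mathsf D_{\mathsf{sg}}(\mathrm{Mod}\,\Gamma)$, naturally in $X\in\mathrm{Gproj}\,\Lambda$. **Proposition.** Let $\Gamma$ and $\Lambda$ be two-sided Noetherian rings and let $(\mathrm{Mod}\,\Gamma,\mathrm{Mod}\,\Lambda,\mathsf i,\mathsf e,\mathsf l)$ be a cleft extension. Assume that $\mathsf F$ is perfect and nilpotent. Then: (i) If $\Lambda$ is CM-free, then $\Gamma$ is CM-free. (ii) If $\mathsf e$ induces a functor $\underline{\mathsf e}\colon\underline{\mathrm{Gproj}}\,\Lambda\to\underline{\mathrm{Gproj}}\,\Gamma$ and $\Gamma$ is CM-free, then $\Lambda$ is CM-free. -/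

import Mathlib

open CategoryTheory CategoryTheory.Limits

universe w v u v' u'

noncomputable section

/-! ### Cleft extensions of abelian categories -/

section CleftExtensions

/-- A cleft extension `(B, A, i, e, l)` of an abelian category `B`: an abelian category `A` with
additive functors `i : B ⥤ A`, `e : A ⥤ B`, `l : B ⥤ A` such that `e` is faithful and exact,
`l` is left adjoint to `e`, and `e ∘ i` is naturally isomorphic to the identity of `B`
(`e` and `l` are then automatically additive). -/
structure CleftExtension (B : Type u) [Category.{v} B] [Abelian B]
    (A : Type u') [Category.{v'} A] [Abelian A] where
  i : B ⥤ A
  e : A ⥤ B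
  l : B ⥤ A
  i_additive : i.Additive
  e_faithful : e.Faithful
  e_preservesFiniteLimits : PreservesFiniteLimits e
  e_preservesFiniteColimits : PreservesFiniteColimits e
  adj : l ⊣ e
  iso : i ⋙ e ≅ 𝟭 B

namespace CleftExtension

variable {B : Type u} [Category.{v} B] [Abelian B] {A : Type u'} [Category.{v'} A] [Abelian A]
  (c : CleftExtension B A)

attribute [instance] CleftExtension.i_additive CleftExtension.e_faithful
  CleftExtension.e_preservesFiniteLimits CleftExtension.e_preservesFiniteColimits

instance e_additive : c.e.Additive := Functor.additive_of_preserves_binary_products c.e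

instance l_additive : c.l.Additive := c.adj.left_adjoint_additive

/-- The endofunctor `G` of `A`, sending `X` to the kernel of the counit `l (e X) ⟶ X`. -/
@[simps]
def G : A ⥤ A where
  obj X := kernel (c.adj.counit.app X)
  map {X Y} f := kernel.map (c.adj.counit.app X) (c.adj.counit.app Y) (c.l.map (c.e.map f)) f
    (c.adj.counit.naturality f).symm
  map_id X := by
    apply equalizer.hom_ext
    simp
  map_comp f g := by
    apply equalizer.hom_ext
    simp

instance G_additive : c.G.Additive where
  map_add {X Y f g} := by
    refine (cancel_mono (kernel.ι (c.adj.counit.app Y))).1 ?_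
    refine Eq.trans ?_ (Preadditive.add_comp _ _ _ _ _ _).symm
    simp [G, kernel.map, kernel.lift_ι, Functor.map_add, Preadditive.comp_add]
    rfl

/-- The endofunctor `F = e G i` of `B`. -/
def F : B ⥤ B := c.i ⋙ c.G ⋙ c.e

instance F_additive : c.F.Additive := by
  unfold F
  infer_instance

end CleftExtension

end CleftExtensions

/-! ### Perfect and nilpotent endofunctors -/

section PerfectEndofunctors

variable {B : Type u} [Category.{v} B]

/-- The iterates `F ^ n` of an endofunctor `F`. -/
def endofunctorPow (F : B ⥤ B) : ℕ → (B ⥤ B)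
  | 0 => 𝟭 B
  | n + 1 => endofunctorPow F n ⋙ F

variable [Abelian B]

instance endofunctorPow_additive (F : B ⥤ B) [F.Additive] :
    ∀ n : ℕ, (endofunctorPow F n).Additive
  | 0 => inferInstanceAs (𝟭 B).Additive
  | n + 1 => by
    have := endofunctorPow_additive F n
    exact inferInstanceAs (endofunctorPow F n ⋙ F).Additive

/-- An endofunctor `F` is nilpotent if `F ^ s = 0` for some `s`. -/
def IsNilpotentEndofunctor (F : B ⥤ B) : Prop :=
  ∃ s : ℕ, ∀ X : B, IsZero ((endofunctorPow F s).obj X)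

/-- Perfect (right exact) endofunctors of an abelian category with enough projectives. -/
structure IsPerfectEndofunctor [EnoughProjectives B] (F : B ⥤ B) [F.Additive] : Prop where
  /-- `𝕃ᵢ(Fʲ)(F P) = 0` for all `i, j ≥ 1` and all projective objects `P`. -/
  condR : ∀ i j : ℕ, 1 ≤ i → 1 ≤ j → ∀ P : B, Projective P →
    IsZero (((endofunctorPow F j).leftDerived i).obj (F.obj P))
  /-- There is `n ≥ 0` with `𝕃ₚ(F^q) = 0` for all `p, q ≥ 1` such that `p + q ≥ n + 1`. -/
  vanishing : ∃ n : ℕ, ∀ p q : ℕ, 1 ≤ p → 1 ≤ q → n + 1 ≤ p + q → ∀ X : B,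
    IsZero (((endofunctorPow F q).leftDerived p).obj X)
  /-- `F P` has finite projective dimension for every projective object `P`. -/
  finite_pd : ∀ P : B, Projective P → ∃ n : ℕ, HasProjectiveDimensionLE (F.obj P) n

end PerfectEndofunctors

/-! ### Gorenstein projective objects and their stable category -/

section GorensteinProjective

variable {A : Type u} [Category.{v} A] [Abelian A]

/-- A complex of projective objects which is acyclic and such that `Hom(K, Q)` is acyclic for
every projective object `Q`. -/
structure IsTotallyAcyclic (K : CochainComplex A ℤ) : Prop where
  projective : ∀ n : ℤ, Projective (K.X n)
  acyclic : K.Acyclic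
  /-- Exactness of `Hom(Kⁿ⁺¹, Q) ⟶ Hom(Kⁿ, Q) ⟶ Hom(Kⁿ⁻¹, Q)`. -/
  hom_acyclic : ∀ Q : A, Projective Q → ∀ (n : ℤ) (f : K.X n ⟶ Q), K.d (n - 1) n ≫ f = 0 →
    ∃ g : K.X (n + 1) ⟶ Q, K.d n (n + 1) ≫ g = f

variable (A)

/-- `X` is Gorenstein projective if it is isomorphic to the image of `K⁻¹ ⟶ K⁰` for a totally
acyclic complex `K` of projective objects. -/
def gorensteinProjective : ObjectProperty A := fun X =>
  ∃ K : CochainComplex A ℤ, IsTotallyAcyclic K ∧ Nonempty (X ≅ image (K.d (-1) 0))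

/-- Two morphisms of Gorenstein projective objects are identified in the stable category if their
difference factors through a projective object. -/
def stableRel : HomRel (gorensteinProjective A).FullSubcategory := fun X Y f g =>
  ∃ P : A, Projective P ∧ ∃ (a : X.obj ⟶ P) (b : P ⟶ Y.obj), f.hom - g.hom = a ≫ b

instance stableRel_congruence : Congruence (stableRel A) where
  equivalence {X Y} :=
    { refl := fun f => by
        obtain ⟨Z, hZ⟩ := HasZeroObject.zero (C := A)
        exact ⟨Z, hZ.projective, 0, 0, by simp⟩
      symm := by
        rintro f g ⟨P, hP, a, b, h⟩
        exact ⟨P, hP, -a, b, by rw [Preadditive.neg_comp, ← h, neg_sub]⟩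
      trans := by
        rintro f g k ⟨P, hP, a, b, h⟩ ⟨P', hP', a', b', h'⟩
        refine ⟨P ⊞ P', inferInstance, biprod.lift a a', biprod.desc b b', ?_⟩
        rw [biprod.lift_desc, ← h, ← h', sub_add_sub_cancel] }
  comp_left := by
    rintro X Y Z f g g' ⟨P, hP, a, b, h⟩
    refine ⟨P, hP, f.hom ≫ a, b, ?_⟩
    rw [Category.assoc, ← h, Preadditive.comp_sub]
    rfl
  comp_right := by
    rintro X Y Z f f' g ⟨P, hP, a, b, h⟩
    refine ⟨P, hP, a, b ≫ g.hom, ?_⟩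
    rw [← Category.assoc, ← h, Preadditive.sub_comp]
    rfl

/-- The stable category of Gorenstein projective objects. -/
abbrev StableGProj := CategoryTheory.Quotient (stableRel A)

/-- The projection from Gorenstein projective objects to their stable category. -/
abbrev toStableGProj : (gorensteinProjective A).FullSubcategory ⥤ StableGProj A :=
  CategoryTheory.Quotient.functor (stableRel A)

end GorensteinProjective

/-! ### The singularity category -/

section Singularity

attribute [local instance] HasDerivedCategory.standard

variable (A : Type u) [Category.{v} A] [Abelian A]

/-- `Kᵇ(Proj A)` as a full subcategory of the bounded derived category of `A`: the objects
isomorphic to a bounded complex of projective objects. -/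
def perfectObjects : ObjectProperty (DerivedCategory.Bounded A) := fun X =>
  ∃ K : CochainComplex A ℤ, (∀ n : ℤ, Projective (K.X n)) ∧
    (∃ a : ℤ, K.IsStrictlyGE a) ∧ (∃ b : ℤ, K.IsStrictlyLE b) ∧
      Nonempty (X.obj ≅ DerivedCategory.Q.obj K)

/-- The singularity category of `A`: the Verdier quotient of the bounded derived category of `A`
by `Kᵇ(Proj A)`. -/
abbrev SingularityCategory := (perfectObjects A).trW.Localization

/-- The embedding of `A` in its bounded derived category (complexes concentrated in degree `0`). -/
def toBounded : A ⥤ DerivedCategory.Bounded A :=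
  ObjectProperty.lift _ (DerivedCategory.singleFunctor A 0)
    (fun _ => ⟨⟨0, inferInstance⟩, ⟨0, inferInstance⟩⟩)

instance toBounded_additive : (toBounded A).Additive where
  map_add {X Y f g} := by
    apply ObjectProperty.hom_ext
    exact (DerivedCategory.singleFunctor A 0).map_add

/-- The functor from `A` to its singularity category. -/
def toSingularity : A ⥤ SingularityCategory A :=
  toBounded A ⋙ (perfectObjects A).trW.Q

variable {A}

lemma toBounded_perfect (P : A) [Projective P] : perfectObjects A ((toBounded A).obj P) := by
  refine ⟨(CochainComplex.singleFunctor A 0).obj P, ?_, ⟨0, inferInstance⟩, ⟨0, inferInstance⟩,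
    ⟨(DerivedCategory.singleFunctorIsoCompQ A 0).app P⟩⟩
  intro n
  by_cases h : n = 0
  · subst h
    exact Projective.of_iso (HomologicalComplex.singleObjXSelf (ComplexShape.up ℤ) 0 P).symm
      inferInstance
  · have : IsZero (((CochainComplex.singleFunctor A 0).obj P).X n) :=
      HomologicalComplex.isZero_single_obj_X (ComplexShape.up ℤ) 0 P n h
    exact this.projective

/-- Morphisms that differ by a morphism factoring through a projective object agree in the
singularity category. -/
lemma toSingularity_map_eq {X Y P : A} [Projective P] (f g : X ⟶ Y) (a : X ⟶ P) (b : P ⟶ Y)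
    (h : f - g = a ≫ b) : (toSingularity A).map f = (toSingularity A).map g := by
  let W := (perfectObjects A).trW
  let T := toBounded A
  have hW : W (biprod.inl : T.obj Y ⟶ T.obj Y ⊞ T.obj P) :=
    ⟨_, _, _, Pretriangulated.binaryBiproductTriangle_distinguished (T.obj Y) (T.obj P),
      toBounded_perfect P⟩
  have := W.Q_inverts _ hW
  have key : W.Q.map (biprod.desc (𝟙 (T.obj Y)) (T.map b)) = W.Q.map biprod.fst := by
    rw [← cancel_epi (W.Q.map (biprod.inl : T.obj Y ⟶ T.obj Y ⊞ T.obj P)),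
      ← Functor.map_comp, ← Functor.map_comp]
    simp
  have hf : T.map f = biprod.lift (T.map g) (T.map a) ≫ biprod.desc (𝟙 _) (T.map b) := by
    rw [biprod.lift_desc, Category.comp_id, ← T.map_comp, ← h, ← T.map_add, add_sub_cancel]
  have hg : T.map g = biprod.lift (T.map g) (T.map a) ≫ biprod.fst := by simp
  change W.Q.map (T.map f) = W.Q.map (T.map g)
  rw [hf, Functor.map_comp, key, ← Functor.map_comp, ← hg]

end Singularity

/-! ### Module categories

Right modules over `R` are left modules over the opposite ring `Rᵐᵒᵖ`. -/

section Modules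

/-- The category of right `R`-modules. -/
abbrev RightMod (R : Type u) [Ring R] := ModuleCat.{u} Rᵐᵒᵖ

/-- The category of finitely generated right `R`-modules (the same as the finitely presented ones
for a right Noetherian ring `R`). -/
abbrev FGRightMod (R : Type u) [Ring R] := FGModuleCat.{u} Rᵐᵒᵖ

/-- The inclusion of finitely generated right modules in all right modules. -/
abbrev FGRightMod.incl (R : Type u) [Ring R] : FGRightMod R ⥤ RightMod R :=
  (ModuleCat.isFG.{u} Rᵐᵒᵖ).ι

/-- A finitely generated module which is projective among finitely generated modules is
projective. -/
lemma FGRightMod.projective_incl {R : Type u} [Ring R] (P : FGRightMod R) [Projective P] :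
    Projective ((FGRightMod.incl R).obj P) := by
  obtain ⟨n, p, hp⟩ := Module.Finite.exists_fin' Rᵐᵒᵖ P
  let L : FGRightMod R := FGModuleCat.of Rᵐᵒᵖ (Fin n → Rᵐᵒᵖ)
  let π : L ⟶ P := ObjectProperty.homMk (ModuleCat.ofHom p)
  have hπ : Epi ((FGRightMod.incl R).map π) := (ModuleCat.epi_iff_surjective _).2 hp
  have : Epi π := (FGRightMod.incl R).epi_of_epi_map hπ
  have hL : Projective ((FGRightMod.incl R).obj L) :=
    ModuleCat.projective_of_free (Pi.basisFun Rᵐᵒᵖ (Fin n))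
  let s : P ⟶ L := Projective.factorThru (𝟙 P) π
  have hs : s ≫ π = 𝟙 P := Projective.factorThru_comp _ _
  exact Retract.projective
    ⟨(FGRightMod.incl R).map s, (FGRightMod.incl R).map π, by rw [← Functor.map_comp, hs]; simp⟩

variable (R : Type u) [Ring R] [IsNoetherianRing Rᵐᵒᵖ]

/-- The category `Gproj R` of finitely generated Gorenstein projective right `R`-modules, i.e. of
the Gorenstein projective objects of the category of finitely generated right modules. -/
abbrev Gproj := (gorensteinProjective (FGRightMod R)).FullSubcategory

/-- `R` is CM-free if the finitely generated Gorenstein projective right `R`-modules are exactly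
the finitely generated projective ones. -/
def IsCMFree : Prop :=
  ∀ X : FGRightMod R, gorensteinProjective (FGRightMod R) X ↔ Projective X

/-- The canonical functor from the stable category of finitely generated Gorenstein projective
right modules to the singularity category of the category of right modules. -/
def stableToSingularity : StableGProj (FGRightMod R) ⥤ SingularityCategory (RightMod R) :=
  CategoryTheory.Quotient.lift (stableRel (FGRightMod R))
    ((gorensteinProjective (FGRightMod R)).ι ⋙ FGRightMod.incl R ⋙ toSingularity (RightMod R))
    (by
      rintro X Y f g ⟨P, hP, a, b, h⟩
      have := FGRightMod.projective_incl P
      refine toSingularity_map_eq ((FGRightMod.incl R).map f.hom) ((FGRightMod.incl R).map g.hom)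
        ((FGRightMod.incl R).map a) ((FGRightMod.incl R).map b) ?_
      rw [← Functor.map_comp, ← h]
      rfl)

variable {R}
variable {S : Type u} [Ring S] [IsNoetherianRing Sᵐᵒᵖ]

/-- An (exact) functor `e` from right `S`-modules to right `R`-modules induces a functor on the
stable categories of finitely generated Gorenstein projective modules if there is a functor `E`
between the stable categories such that the image of `E X` in the singularity category is
isomorphic to that of `e X`, naturally in the finitely generated Gorenstein projective
module `X`. -/
def InducesStableFunctor (e : RightMod S ⥤ RightMod R) : Prop :=
  ∃ E : StableGProj (FGRightMod S) ⥤ StableGProj (FGRightMod R),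
    Nonempty (toStableGProj (FGRightMod S) ⋙ E ⋙ stableToSingularity R ≅
      (gorensteinProjective (FGRightMod S)).ι ⋙ FGRightMod.incl S ⋙ e ⋙
        toSingularity (RightMod R))

end Modules

end

/-! The adjunction and the isomorphism `e i ≅ Id` split `e (l X)` naturally as `X ⊕ F X`, and `e G ≅
F e` on objects. Hence `l` preserves every monomorphism that `F` preserves, `e P` is a summand of
some `Q ⊕ F Q` with `Q` projective whenever `P` is projective, and the sequences `0 → G X → l (e X)
→ X → 0` can be iterated until they stop, because `e Gˢ ≅ Fˢ e = 0`.

Perfectness provides acyclicity. The cosyzygies of an acyclic complex of projectives continue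
indefinitely to the right, so a bound on the degrees in which `𝕃ₚ(F^q)` can be nonzero forces these
functors to vanish on all of them, by dimension shifting (`SyzygyFlat.of_cosyzygies`).

For (i), `l` preserves totally acyclic complexes (`mapTotalSyzygies`). Exactness comes from
acyclicity, and `Hom(l P, Q) = Hom(P, e Q)` is acyclic since `e Q` has finite projective dimension.
Finite generation of `l X` rests on a Nakayama lemma (`finite_l`). So `l X` is Gorenstein
projective, hence projective, and then so is `X` (`projective_of_l`).

For (ii), `e X` is isomorphic in the singularity category to a Gorenstein projective, hence
projective, module, so it has finite projective dimension. This passes to `X` through the iterated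
sequences (`hasFiniteProjectiveDimension_of_e`), and a Gorenstein projective of finite projective
dimension is projective (`TotalSyzygies.projective_Z`). -/

noncomputable section

namespace CategoryTheory

/-! ### Vanishing of left derived functors, read off from syzygies -/

section SyzygyFlat

variable {C : Type u} [Category.{v} C] [Abelian C] {D : Type u'} [Category.{v'} D] [Abelian D]

lemma Functor.map_exact_and_epi (T : C ⥤ D) [T.Additive] [h : PreservesFiniteColimits T]
    (S : ShortComplex C) (hS : S.Exact ∧ Epi S.g) : (S.map T).Exact ∧ Epi (T.map S.g) := by
  have key : (∀ S : ShortComplex C, S.Exact ∧ Epi S.g → (S.map T).Exact ∧ Epi (T.map S.g)) ↔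
      PreservesFiniteColimits T := (Functor.preservesFiniteColimits_tfae T).out 1 3
  exact key.2 h S hS

/-- The augmentation of a projective resolution. -/
def ProjectiveResolution.ε {X : C} (R : ProjectiveResolution X) : R.complex.X 0 ⟶ X := R.π.f 0

lemma ProjectiveResolution.d_comp_ε {X : C} (R : ProjectiveResolution X) :
    R.complex.d 1 0 ≫ R.ε = 0 := R.complex_d_comp_π_f_zero

lemma ProjectiveResolution.exact_ε {X : C} (R : ProjectiveResolution X) :
    (ShortComplex.mk _ _ R.d_comp_ε).Exact := R.exact₀

instance ProjectiveResolution.epi_ε {X : C} (R : ProjectiveResolution X) : Epi R.ε :=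
  inferInstanceAs (Epi (R.π.f 0))

/-- A projective resolution of `S.X₁` can be spliced with a short exact sequence `S` whose middle
term is projective. -/
def ProjectiveResolution.splice {S : ShortComplex C} (hS : S.ShortExact) [Projective S.X₂]
    (R : ProjectiveResolution S.X₁) : ProjectiveResolution S.X₃ where
  complex := R.complex.augment (R.ε ≫ S.f) (by rw [reassoc_of% R.d_comp_ε, zero_comp])
  projective n := by
    cases n
    · exact inferInstanceAs (Projective S.X₂)
    · exact R.projective _
  hasHomology _ := inferInstance
  π := (ChainComplex.toSingle₀Equiv _ _).symm ⟨S.g,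
    show (R.ε ≫ S.f) ≫ S.g = 0 by rw [Category.assoc, S.zero, comp_zero]⟩
  quasiIso := ⟨fun n => by
    cases n with
    | zero =>
      rw [ChainComplex.quasiIsoAt₀_iff, ShortComplex.quasiIso_iff_of_zeros']
      · have := hS.epi_g
        have h : (ShortComplex.mk (R.ε ≫ S.f) S.g (by
            rw [Category.assoc, S.zero, comp_zero])).Exact := by
          let φ : ShortComplex.mk (R.ε ≫ S.f) S.g (by rw [Category.assoc, S.zero, comp_zero]) ⟶ S :=
            { τ₁ := R.ε, τ₂ := 𝟙 _, τ₃ := 𝟙 _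
              comm₁₂ := (Category.comp_id (R.ε ≫ S.f)).symm
              comm₂₃ := by simp }
          have : Epi φ.τ₁ := inferInstanceAs (Epi (R.ε))
          have : IsIso φ.τ₂ := inferInstanceAs (IsIso (𝟙 _))
          have : Mono φ.τ₃ := inferInstanceAs (Mono (𝟙 _))
          exact (ShortComplex.exact_iff_of_epi_of_isIso_of_mono φ).2 hS.exact
        refine (ShortComplex.exact_and_epi_g_iff_of_iso ?_).2 ⟨h, this⟩
        refine ShortComplex.isoMk (Iso.refl _) (Iso.refl _) (Iso.refl _) ?_ ?_
        · exact (Category.id_comp _).trans (Category.comp_id _).symm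
        · refine (Category.id_comp _).trans ((Category.comp_id _).trans ?_).symm
          exact ChainComplex.toSingle₀Equiv_symm_apply_f_zero
            (C := R.complex.augment (R.ε ≫ S.f) _) (X := S.X₃) S.g _
      all_goals rfl
    | succ n =>
      rw [quasiIsoAt_iff_exactAt']
      · rw [HomologicalComplex.exactAt_iff' _ (n + 1 + 1) (n + 1) n (by simp) (by simp)]
        cases n with
        | zero =>
          have := hS.mono_f
          have h := R.exact_ε
          let φ : ShortComplex.mk _ _ R.d_comp_ε ⟶
              ShortComplex.mk (R.complex.d 1 0) (R.ε ≫ S.f)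
                (by rw [reassoc_of% R.d_comp_ε, zero_comp]) :=
            { τ₁ := 𝟙 _, τ₂ := 𝟙 _, τ₃ := S.f
              comm₁₂ := by simp
              comm₂₃ := Category.id_comp _ }
          have : Epi φ.τ₁ := inferInstanceAs (Epi (𝟙 _))
          have : IsIso φ.τ₂ := inferInstanceAs (IsIso (𝟙 _))
          have : Mono φ.τ₃ := inferInstanceAs (Mono S.f)
          exact (ShortComplex.exact_iff_of_epi_of_isIso_of_mono φ).1 h
        | succ n => exact R.exact_succ n
      · apply ChainComplex.exactAt_succ_single_obj⟩

/-- `T` is flat at the `n`-th syzygies of `X`: for all short exact sequences `K ⟶ P ⟶ Y` with `P`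
projective and `Y` an `n`-th syzygy of `X`, the morphism `T K ⟶ T P` is a monomorphism. If `T` is
right exact, this says that the left derived functor `𝕃ₙ₊₁T` vanishes on `X`. -/
def SyzygyFlat (T : C ⥤ D) : ℕ → C → Prop
  | 0, X => ∀ ⦃K P : C⦄ (f : K ⟶ P) (g : P ⟶ X) (w : f ≫ g = 0),
      (ShortComplex.mk f g w).ShortExact → Projective P → Mono (T.map f)
  | n + 1, X => ∀ ⦃K P : C⦄ (f : K ⟶ P) (g : P ⟶ X) (w : f ≫ g = 0),
      (ShortComplex.mk f g w).ShortExact → Projective P → SyzygyFlat T n K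

/-- Resolve `X` by splicing a resolution `R` of `K` with `K ⟶ P ⟶ X`. For `n = 0`, exactness in
degree `1` says that the kernel of `T (R.ε ≫ f)` is the image of `T d`, which `T R.ε` kills; as `T
R.ε` is epi, `T f` is mono. For larger `n`, the spliced resolution only shifts the degree by one. -/
lemma SyzygyFlat.of_isZero_leftDerived [HasProjectiveResolutions C] (T : C ⥤ D) [T.Additive]
    [PreservesFiniteColimits T] (n : ℕ) {X : C} (h : IsZero ((T.leftDerived (n + 1)).obj X)) :
    SyzygyFlat T n X := by
  induction n generalizing X with
  | zero =>
    intro K P f g w hS hP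
    let R := projectiveResolution K
    have : Projective (ShortComplex.mk f g w).X₂ := hP
    have h1 := h.of_iso ((R.splice hS).isoLeftDerivedObj T 1).symm
    erw [← HomologicalComplex.exactAt_iff_isZero_homology,
      HomologicalComplex.exactAt_iff' _ 2 1 0 (by simp) (by simp)] at h1
    have h2 : (ShortComplex.mk (T.map (R.complex.d 1 0)) (T.map (R.ε ≫ f)) (by
        rw [← T.map_comp, reassoc_of% R.d_comp_ε, zero_comp, T.map_zero])).Exact := h1
    have h3 : (ShortComplex.mk (T.map (R.complex.d 1 0)) (T.map (R.ε)) (by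
        rw [← T.map_comp, R.d_comp_ε, T.map_zero])).Exact ∧ Epi (T.map (R.ε)) :=
      T.map_exact_and_epi
        (ShortComplex.mk _ _ R.d_comp_ε) ⟨R.exact_ε, R.epi_ε⟩
    rw [Preadditive.mono_iff_cancel_zero]
    intro A a ha
    have := h3.2
    obtain ⟨A', π, hπ, x, hx⟩ := surjective_up_to_refinements_of_epi (T.map (R.ε)) a
    obtain ⟨A'', π', hπ', y, hy⟩ := h2.exact_up_to_refinements x (by
      change x ≫ T.map (R.ε ≫ f) = 0
      rw [T.map_comp (R.ε) f, ← Category.assoc, ← hx, Category.assoc, ha, comp_zero])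
    rw [← cancel_epi π, ← cancel_epi π', comp_zero, comp_zero, hx]
    dsimp only at hy
    rw [← Category.assoc, hy, Category.assoc, ← T.map_comp, R.d_comp_ε, T.map_zero, comp_zero]
  | succ n ih =>
    intro K P f g w hS hP
    let R := projectiveResolution K
    have : Projective (ShortComplex.mk f g w).X₂ := hP
    have h1 := h.of_iso ((R.splice hS).isoLeftDerivedObj T (n + 1 + 1)).symm
    apply ih
    refine IsZero.of_iso ?_ (R.isoLeftDerivedObj T (n + 1))
    erw [← HomologicalComplex.exactAt_iff_isZero_homology,
      HomologicalComplex.exactAt_iff' _ (n + 2 + 1) (n + 2) (n + 1) (by simp) (by simp)] at h1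
    erw [← HomologicalComplex.exactAt_iff_isZero_homology,
      HomologicalComplex.exactAt_iff' _ (n + 1 + 1) (n + 1) n (by simp) (by simp)]
    exact h1

end SyzygyFlat
end CategoryTheory

namespace CategoryTheory

section SyzygyFlat

variable {C : Type u} [Category.{v} C] [Abelian C] {D : Type u'} [Category.{v'} D] [Abelian D]

lemma ShortComplex.shortExact_kernel {X Y : C} (g : X ⟶ Y) [Epi g] :
    (ShortComplex.mk (kernel.ι g) g (kernel.condition g)).ShortExact :=
  ShortComplex.ShortExact.mk' (ShortComplex.exact_kernel g) inferInstance ‹_›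

/-- If `𝕃₁T` vanishes on the last term of a short exact sequence, then `T` preserves the
monomorphism of this sequence. -/
lemma SyzygyFlat.mono_map [EnoughProjectives C] {T : C ⥤ D} [T.Additive]
    [PreservesFiniteColimits T] {S : ShortComplex C} (hS : S.ShortExact)
    (h : SyzygyFlat T 0 S.X₃) : Mono (T.map S.f) := by
  have := hS.mono_f
  have := hS.epi_g
  let π := Projective.π S.X₂
  have hk : Mono (T.map (kernel.ι (π ≫ S.g))) :=
    h _ _ _ (ShortComplex.shortExact_kernel (π ≫ S.g)) inferInstance
  -- `q` presents `X₁` as the quotient of `ker (π ≫ S.g)` by `ker π`. An element of `T X₁` killed by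
  -- `T S.f` lifts along `T q`; the lift comes from `T (ker π)`, because `T` preserves the inclusion
  -- of `ker (π ≫ S.g)`, and therefore dies in `T X₁`.
  let q : kernel (π ≫ S.g) ⟶ S.X₁ := hS.exact.lift (kernel.ι (π ≫ S.g) ≫ π) (by simp)
  have hq : q ≫ S.f = kernel.ι (π ≫ S.g) ≫ π := hS.exact.lift_f _ _
  let j : kernel π ⟶ kernel (π ≫ S.g) := kernel.lift _ (kernel.ι π) (by simp)
  have hj : j ≫ kernel.ι (π ≫ S.g) = kernel.ι π := kernel.lift_ι _ _ _
  have hjq : j ≫ q = 0 := by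
    rw [← cancel_mono S.f, Category.assoc, hq, ← Category.assoc, hj, kernel.condition, zero_comp]
  have hqe : Epi q := by
    rw [epi_iff_surjective_up_to_refinements]
    intro A x
    obtain ⟨A', p, hp, y, hy⟩ := surjective_up_to_refinements_of_epi π (x ≫ S.f)
    refine ⟨A', p, hp, kernel.lift _ y ?_, ?_⟩
    · rw [← Category.assoc, ← hy, Category.assoc, Category.assoc, S.zero, comp_zero, comp_zero]
    · rw [← cancel_mono S.f, Category.assoc, Category.assoc, hq]
      exact hy.trans (kernel.lift_ι_assoc _ _ _ _).symm
  have hjqe : (ShortComplex.mk j q hjq).Exact := by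
    rw [ShortComplex.exact_iff_exact_up_to_refinements]
    intro A x hx
    dsimp only at x hx
    refine ⟨A, 𝟙 A, inferInstance, kernel.lift π (x ≫ kernel.ι _) ?_, ?_⟩
    · rw [Category.assoc, ← hq, ← Category.assoc, hx, zero_comp]
    · rw [← cancel_mono (kernel.ι (π ≫ S.g))]
      simp [hj]
  obtain ⟨h1, h2⟩ := T.map_exact_and_epi _ ⟨hjqe, hqe⟩
  obtain ⟨h3, -⟩ := T.map_exact_and_epi _
    ⟨ShortComplex.exact_kernel π, (inferInstance : Epi π)⟩
  rw [Preadditive.mono_iff_cancel_zero]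
  intro A a ha
  obtain ⟨A', p, hp, x, hx⟩ := surjective_up_to_refinements_of_epi (T.map q) a
  obtain ⟨A'', p', hp', (y : A'' ⟶ T.obj (kernel π)), hy⟩ :=
    h3.exact_up_to_refinements (x ≫ T.map (kernel.ι (π ≫ S.g))) (by
    change (x ≫ T.map _) ≫ T.map _ = 0
    rw [Category.assoc, ← T.map_comp, ← hq, T.map_comp, ← Category.assoc, ← hx, Category.assoc,
      ha, comp_zero])
  have hy' : p' ≫ x = y ≫ T.map j := by
    rw [← cancel_mono (T.map (kernel.ι (π ≫ S.g))), Category.assoc, Category.assoc, ← T.map_comp,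
      hj]
    exact hy
  rw [← cancel_epi p, ← cancel_epi p', comp_zero, comp_zero, hx, ← Category.assoc, hy',
    Category.assoc, ← T.map_comp, hjq, T.map_zero, comp_zero]

/-- The first step of the horseshoe lemma. -/
lemma ShortComplex.ShortExact.exists_syzygies [EnoughProjectives C] {S : ShortComplex C}
    (hS : S.ShortExact) {K P : C} (f : K ⟶ P) (g : P ⟶ S.X₁) (w : f ≫ g = 0)
    (hT : (ShortComplex.mk f g w).ShortExact) (hP : Projective P) :
      ∃ (E Q Y R : C) (a : E ⟶ Q) (b : Q ⟶ S.X₂) (w₂ : a ≫ b = 0) (c : Y ⟶ R) (d : R ⟶ S.X₃)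
        (w₃ : c ≫ d = 0) (i : K ⟶ E) (r : E ⟶ Y) (w₁ : i ≫ r = 0) (j : P ⟶ Q),
        Projective Q ∧ Projective R ∧ (ShortComplex.mk a b w₂).ShortExact ∧
        (ShortComplex.mk c d w₃).ShortExact ∧ (ShortComplex.mk i r w₁).ShortExact ∧
        i ≫ a = f ≫ j := by
  have := hS.mono_f
  have := hS.epi_g
  have : Mono f := hT.mono_f
  have : Epi g := hT.epi_g
  let π := Projective.π S.X₂
  -- Covering `X₃` by the chosen cover of `X₂` makes the horseshoe explicit: `π` itself is the lift
  -- to `X₂`.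
  let α : P ⊞ Projective.over S.X₂ ⟶ S.X₂ := biprod.desc (g ≫ S.f) π
  have hα' : kernel.ι α ≫ (biprod.fst ≫ g ≫ S.f + biprod.snd ≫ π) = 0 := by
    have h : α = biprod.fst ≫ g ≫ S.f + biprod.snd ≫ π := by
      apply biprod.hom_ext' <;> simp [α]
    rw [← h]
    exact kernel.condition α
  have hα : Epi α := by
    have : Epi (biprod.inr ≫ α) := by simpa [α] using (inferInstance : Epi π)
    exact epi_of_epi biprod.inr α
  let i : K ⟶ kernel α := kernel.lift α (f ≫ biprod.inl) (by simp [α, reassoc_of% w])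
  let r : kernel α ⟶ kernel (π ≫ S.g) := kernel.lift _ (kernel.ι α ≫ biprod.snd) (by
    simpa using hα' =≫ S.g)
  have hi : i ≫ kernel.ι α = f ≫ biprod.inl := kernel.lift_ι _ _ _
  have hr : r ≫ kernel.ι (π ≫ S.g) = kernel.ι α ≫ biprod.snd := kernel.lift_ι _ _ _
  refine ⟨kernel α, _, kernel (π ≫ S.g), _, kernel.ι α, α, kernel.condition α, kernel.ι _,
    π ≫ S.g, kernel.condition _, i, r, ?_, biprod.inl, inferInstance, inferInstance,
    ShortComplex.shortExact_kernel _, ShortComplex.shortExact_kernel _, ?_, hi⟩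
  · rw [← cancel_mono (kernel.ι (π ≫ S.g)), Category.assoc, hr, reassoc_of% hi]
    simp
  · refine ShortComplex.ShortExact.mk' ?_ ?_ ?_
    · rw [ShortComplex.exact_iff_exact_up_to_refinements]
      intro A x hx
      dsimp only at x hx
      have h1 : x ≫ kernel.ι α ≫ biprod.snd = 0 := by
        rw [← hr, reassoc_of% hx, zero_comp]
      have h2 : (x ≫ kernel.ι α ≫ biprod.fst) ≫ g = 0 := by
        rw [← cancel_mono S.f, zero_comp]
        simpa [reassoc_of% h1] using x ≫= hα'
      refine ⟨A, 𝟙 A, inferInstance, hT.exact.lift _ h2, ?_⟩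
      dsimp only
      rw [← cancel_mono (kernel.ι α), Category.id_comp, Category.assoc, hi]
      apply biprod.hom_ext
      · simp only [Category.assoc, biprod.inl_fst, Category.comp_id]
        exact (hT.exact.lift_f _ h2).symm
      · simp [h1]
    · have : Mono (i ≫ kernel.ι α) := by rw [hi]; infer_instance
      exact mono_of_mono i (kernel.ι α)
    · dsimp only
      rw [epi_iff_surjective_up_to_refinements]
      intro A y
      have hy : (y ≫ kernel.ι _ ≫ π) ≫ S.g = 0 := by simp
      obtain ⟨A', p, hp, x, hx⟩ := surjective_up_to_refinements_of_epi g (hS.exact.lift _ hy)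
      refine ⟨A', p, hp, kernel.lift α (biprod.lift (-x) (p ≫ y ≫ kernel.ι _)) ?_, ?_⟩
      · have := hS.exact.lift_f _ hy
        simp only [α, biprod.lift_desc, Preadditive.neg_comp]
        rw [reassoc_of% hx.symm, this]
        simp
      · rw [← cancel_mono (kernel.ι (π ≫ S.g))]
        simp [hr]

/-- Given a short exact sequence `X₁ ⟶ X₂ ⟶ X₃`, an exact portion of the long exact sequence of
left derived functors. -/
lemma SyzygyFlat.X₁ [EnoughProjectives C] {T : C ⥤ D} [T.Additive]
    [PreservesFiniteColimits T] (n : ℕ) {S : ShortComplex C} (hS : S.ShortExact)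
    (h₂ : SyzygyFlat T n S.X₂) (h₃ : SyzygyFlat T (n + 1) S.X₃) : SyzygyFlat T n S.X₁ := by
  induction n generalizing S with
  | zero =>
    intro K P f g w hT hP
    obtain ⟨E, Q, Y, R, a, b, w₂, c, d, w₃, i, r, w₁, j, hQ, hR, hS₂, hS₃, hS₁, h⟩ :=
      hS.exists_syzygies f g w hT hP
    have h1 := h₂ a b w₂ hS₂ hQ
    have h2 : Mono (T.map i) := (h₃ c d w₃ hS₃ hR).mono_map hS₁
    have : Mono (T.map f ≫ T.map j) := by
      rw [← T.map_comp, ← h, T.map_comp]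
      infer_instance
    exact mono_of_mono (T.map f) (T.map j)
  | succ n ih =>
    intro K P f g w hT hP
    obtain ⟨E, Q, Y, R, a, b, w₂, c, d, w₃, i, r, w₁, j, hQ, hR, hS₂, hS₃, hS₁, h⟩ :=
      hS.exists_syzygies f g w hT hP
    exact ih hS₁ (h₂ a b w₂ hS₂ hQ) (h₃ c d w₃ hS₃ hR)

end SyzygyFlat

/-! ### Objects of finite projective dimension -/

section FiniteProjectiveDimension

variable {C : Type u} [Category.{v} C] [Abelian C] {D : Type u'} [Category.{v'} D] [Abelian D]

/-- Objects of finite projective dimension. -/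
def HasFiniteProjectiveDimension (X : C) : Prop := ∃ n : ℕ, HasProjectiveDimensionLT X n

lemma HasFiniteProjectiveDimension.of_projective (X : C) [Projective X] :
    HasFiniteProjectiveDimension X := ⟨1, inferInstance⟩

lemma HasFiniteProjectiveDimension.of_isZero {X : C} (h : IsZero X) :
    HasFiniteProjectiveDimension X := ⟨0, h.hasProjectiveDimensionLT_zero⟩

lemma HasFiniteProjectiveDimension.of_retract {X Y : C} (h : HasFiniteProjectiveDimension Y)
    (r : Retract X Y) : HasFiniteProjectiveDimension X := by
  obtain ⟨n, hn⟩ := h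
  exact ⟨n, r.hasProjectiveDimensionLT n⟩

lemma HasFiniteProjectiveDimension.X₂ {S : ShortComplex C} (hS : S.ShortExact)
    (h₁ : HasFiniteProjectiveDimension S.X₁) (h₃ : HasFiniteProjectiveDimension S.X₃) :
    HasFiniteProjectiveDimension S.X₂ := by
  obtain ⟨n, hn⟩ := h₁
  obtain ⟨m, hm⟩ := h₃
  exact ⟨n + m, hS.hasProjectiveDimensionLT_X₂ _ inferInstance inferInstance⟩

lemma HasFiniteProjectiveDimension.X₃ {S : ShortComplex C} (hS : S.ShortExact)
    (h₁ : HasFiniteProjectiveDimension S.X₁) (h₂ : HasFiniteProjectiveDimension S.X₂) :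
    HasFiniteProjectiveDimension S.X₃ := by
  obtain ⟨n, hn⟩ := h₁
  obtain ⟨m, hm⟩ := h₂
  exact ⟨n + m + 1, hS.hasProjectiveDimensionLT_X₃ _ inferInstance inferInstance⟩

/-- A right exact functor `T` which sends projective objects to objects of finite projective
dimension preserves finite projective dimension of `T`-acyclic objects. -/
lemma HasFiniteProjectiveDimension.map [EnoughProjectives C] (T : C ⥤ D) [T.Additive]
    [PreservesFiniteColimits T]
    (hT : ∀ P : C, Projective P → HasFiniteProjectiveDimension (T.obj P)) {Y : C}
    (hY : HasFiniteProjectiveDimension Y) (h : ∀ n, SyzygyFlat T n Y) :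
    HasFiniteProjectiveDimension (T.obj Y) := by
  -- The bound `m + 1` makes the base case say that `Y` is projective.
  suffices ∀ m : ℕ, ∀ Y : C, HasProjectiveDimensionLT Y (m + 1) → (∀ n, SyzygyFlat T n Y) →
      HasFiniteProjectiveDimension (T.obj Y) by
    obtain ⟨m, hm⟩ := hY
    exact this m Y (hasProjectiveDimensionLT_of_ge Y m _ (by lia)) h
  intro m
  induction m with
  | zero =>
    intro Y hY _
    exact hT _ (projective_iff_hasProjectiveDimensionLT_one.2 hY)
  | succ m ih =>
    intro Y hY h
    have hS := ShortComplex.shortExact_kernel (Projective.π Y)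
    have h₁ := ih _ ((hS.hasProjectiveDimensionLT_X₃_iff m inferInstance).1 hY)
      (fun n => h (n + 1) _ _ _ hS inferInstance)
    obtain ⟨he, hepi⟩ := T.map_exact_and_epi _ ⟨hS.exact, hS.epi_g⟩
    exact .X₃ (ShortComplex.ShortExact.mk' he (h 0 _ _ _ hS inferInstance) hepi) h₁
      (hT _ inferInstance)

end FiniteProjectiveDimension
end CategoryTheory

/-! ### The splitting of `e l`, and Nakayama's lemma -/

namespace CleftExtension

variable {B : Type u} [Category.{v} B] [Abelian B] {A : Type u'} [Category.{v'} A] [Abelian A]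
  (c : CleftExtension B A)

instance : PreservesFiniteColimits c.l := by
  have := c.adj.leftAdjoint_preservesColimits
  infer_instance

/-- The counit `l (e X) ⟶ X`. -/
def ε (X : A) : c.l.obj (c.e.obj X) ⟶ X := c.adj.counit.app X

/-- The unit `X ⟶ e (l X)`. -/
def η (X : B) : X ⟶ c.e.obj (c.l.obj X) := c.adj.unit.app X

/-- The isomorphism `e (i X) ≅ X`. -/
def θ (X : B) : c.e.obj (c.i.obj X) ≅ X := c.iso.app X

instance epi_ε (X : A) : Epi (c.ε X) := inferInstanceAs (Epi (c.adj.counit.app X))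

lemma ε_naturality {X Y : A} (f : X ⟶ Y) : c.l.map (c.e.map f) ≫ c.ε Y = c.ε X ≫ f :=
  c.adj.counit.naturality f

lemma η_naturality {X Y : B} (f : X ⟶ Y) : f ≫ c.η Y = c.η X ≫ c.e.map (c.l.map f) :=
  c.adj.unit.naturality f

lemma θ_naturality {X Y : B} (f : X ⟶ Y) :
    c.e.map (c.i.map f) ≫ (c.θ Y).hom = (c.θ X).hom ≫ f := c.iso.hom.naturality f

lemma θ_inv_naturality {X Y : B} (f : X ⟶ Y) :
    f ≫ (c.θ Y).inv = (c.θ X).inv ≫ c.e.map (c.i.map f) := c.iso.inv.naturality f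

@[simp]
lemma η_ε (X : A) : c.η (c.e.obj X) ≫ c.e.map (c.ε X) = 𝟙 _ :=
  c.adj.right_triangle_components X

/-- The inclusion of `G X` in `l (e X)`. -/
def ι (X : A) : c.G.obj X ⟶ c.l.obj (c.e.obj X) := kernel.ι (c.adj.counit.app X)

@[simp]
lemma ι_ε (X : A) : c.ι X ≫ c.ε X = 0 := kernel.condition _

lemma shortExact_G (X : A) : (ShortComplex.mk _ _ (c.ι_ε X)).ShortExact :=
  ShortComplex.shortExact_kernel (c.adj.counit.app X)

lemma ι_naturality {X Y : A} (f : X ⟶ Y) :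
    c.G.map f ≫ c.ι Y = c.ι X ≫ c.l.map (c.e.map f) := kernel.lift_ι _ _ _

/-- The inclusion of `e (G X)` in `e (l (e X))`. -/
def κ (X : A) : c.e.obj (c.G.obj X) ⟶ c.e.obj (c.l.obj (c.e.obj X)) := c.e.map (c.ι X)

instance mono_κ (X : A) : Mono (c.κ X) := by
  have : Mono (c.ι X) := (c.shortExact_G X).mono_f
  unfold κ
  infer_instance

@[simp]
lemma κ_ε (X : A) : c.κ X ≫ c.e.map (c.ε X) = 0 := by
  rw [κ, ← c.e.map_comp, ι_ε, c.e.map_zero]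

lemma κ_naturality {X Y : A} (f : X ⟶ Y) :
    c.e.map (c.G.map f) ≫ c.κ Y = c.κ X ≫ c.e.map (c.l.map (c.e.map f)) := by
  rw [κ, κ, ← c.e.map_comp, ι_naturality, c.e.map_comp]

lemma exact_κ (X : A) : (ShortComplex.mk _ _ (c.κ_ε X)).Exact :=
  ((c.shortExact_G X).map_of_exact c.e).exact

instance mono_κ' (X : A) : Mono (ShortComplex.mk _ _ (c.κ_ε X)).f := c.mono_κ X

/-- The retraction of `e (l (e X))` on `e (G X)`. -/
def ρ (X : A) : c.e.obj (c.l.obj (c.e.obj X)) ⟶ c.e.obj (c.G.obj X) :=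
  (c.exact_κ X).lift (𝟙 _ - c.e.map (c.ε X) ≫ c.η (c.e.obj X)) (by simp)

lemma ρ_κ (X : A) : c.ρ X ≫ c.κ X = 𝟙 _ - c.e.map (c.ε X) ≫ c.η (c.e.obj X) :=
  (c.exact_κ X).lift_f _ _

@[simp]
lemma κ_ρ (X : A) : c.κ X ≫ c.ρ X = 𝟙 _ := by
  rw [← cancel_mono (c.κ X), Category.assoc, ρ_κ]
  simp [reassoc_of% c.κ_ε]

@[simp]
lemma η_ρ (X : A) : c.η (c.e.obj X) ≫ c.ρ X = 0 := by
  rw [← cancel_mono (c.κ X), Category.assoc, ρ_κ]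
  simp [reassoc_of% c.η_ε]

lemma ρ_naturality {X Y : A} (f : X ⟶ Y) :
    c.e.map (c.l.map (c.e.map f)) ≫ c.ρ Y = c.ρ X ≫ c.e.map (c.G.map f) := by
  rw [← cancel_mono (c.κ Y), Category.assoc, Category.assoc, κ_naturality, ρ_κ, reassoc_of% c.ρ_κ,
    Preadditive.comp_sub, Preadditive.sub_comp, ← c.e.map_comp_assoc, ε_naturality,
    c.e.map_comp_assoc, η_naturality]
  simp

/-- The retraction `e (l X) ⟶ X` of the unit which is induced by `i`. -/
def σ (X : B) : c.e.obj (c.l.obj X) ⟶ X :=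
  c.e.map (c.l.map (c.θ X).inv) ≫ c.e.map (c.ε (c.i.obj X)) ≫ (c.θ X).hom

lemma σ_naturality {X Y : B} (f : X ⟶ Y) :
    c.e.map (c.l.map f) ≫ c.σ Y = c.σ X ≫ f := by
  simp only [σ, Category.assoc]
  rw [← c.e.map_comp_assoc, ← c.l.map_comp, θ_inv_naturality, ← c.e.map_comp_assoc,
    c.l.map_comp, Category.assoc, ε_naturality, ← c.θ_naturality]
  simp

@[simp]
lemma η_σ (X : B) : c.η X ≫ c.σ X = 𝟙 X := by
  rw [σ, ← reassoc_of% c.η_naturality, reassoc_of% c.η_ε, Iso.inv_hom_id]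

/-- The inclusion of `F X` in `e (l X)`. -/
def κF (X : B) : c.F.obj X ⟶ c.e.obj (c.l.obj X) :=
  (c.κ (c.i.obj X) ≫ c.e.map (c.l.map (c.θ X).hom) :)

/-- The retraction of `e (l X)` on `F X`. -/
def ρF (X : B) : c.e.obj (c.l.obj X) ⟶ c.F.obj X :=
  (c.e.map (c.l.map (c.θ X).inv) ≫ c.ρ (c.i.obj X) :)

instance mono_κF (X : B) : Mono (c.κF X) :=
  inferInstanceAs (Mono (c.κ (c.i.obj X) ≫ c.e.map (c.l.map (c.θ X).hom)))

@[simp]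
lemma κF_ρF (X : B) : c.κF X ≫ c.ρF X = 𝟙 _ := by
  have : (c.κ (c.i.obj X) ≫ c.e.map (c.l.map (c.θ X).hom)) ≫
    (c.e.map (c.l.map (c.θ X).inv) ≫ c.ρ (c.i.obj X)) = 𝟙 _ := by
    rw [Category.assoc, ← c.e.map_comp_assoc, ← c.l.map_comp]
    simp
  exact this

/-- With `η_σ`, `κF_ρF` and `η_ρF`, this exhibits `e (l X)` as the biproduct of `X` and `F X`. -/
lemma ρF_κF (X : B) : c.ρF X ≫ c.κF X = 𝟙 _ - c.σ X ≫ c.η X := by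
  have : (c.e.map (c.l.map (c.θ X).inv) ≫ c.ρ (c.i.obj X)) ≫
      (c.κ (c.i.obj X) ≫ c.e.map (c.l.map (c.θ X).hom)) = 𝟙 _ - c.σ X ≫ c.η X := by
    simp only [σ, Category.assoc, reassoc_of% c.ρ_κ, Preadditive.sub_comp,
      Preadditive.comp_sub, Category.id_comp, c.η_naturality (c.θ X).hom]
    rw [← c.e.map_comp, ← c.l.map_comp]
    simp
  exact this

@[simp]
lemma η_ρF (X : B) : c.η X ≫ c.ρF X = 0 := by
  rw [← cancel_mono (c.κF X), Category.assoc, ρF_κF]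
  simp [reassoc_of% c.η_σ]

lemma ρF_naturality {X Y : B} (f : X ⟶ Y) :
    c.e.map (c.l.map f) ≫ c.ρF Y = c.ρF X ≫ c.F.map f := by
  have : c.e.map (c.l.map f) ≫ c.e.map (c.l.map (c.θ Y).inv) ≫ c.ρ (c.i.obj Y) =
      (c.e.map (c.l.map (c.θ X).inv) ≫ c.ρ (c.i.obj X)) ≫ c.e.map (c.G.map (c.i.map f)) := by
    rw [Category.assoc, ← ρ_naturality, ← c.e.map_comp_assoc, ← c.e.map_comp_assoc,
      ← c.l.map_comp, ← c.l.map_comp, θ_inv_naturality]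
  exact this

/-- The idempotent `σ ≫ η` is natural, hence so is its complement `ρF ≫ κF`; cancel the split
epimorphism `ρF`. -/
lemma κF_naturality {X Y : B} (f : X ⟶ Y) :
    c.F.map f ≫ c.κF Y = c.κF X ≫ c.e.map (c.l.map f) := by
  have : IsSplitEpi (c.ρF X) := ⟨⟨c.κF X, c.κF_ρF X⟩⟩
  rw [← cancel_epi (c.ρF X), ← reassoc_of% c.ρF_naturality, ρF_κF, reassoc_of% c.ρF_κF]
  simp [Preadditive.sub_comp, Preadditive.comp_sub, ← η_naturality, reassoc_of% c.σ_naturality]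

/-- `F` is a natural direct summand of `l ⋙ e`, a left adjoint followed by an exact functor. -/
instance : PreservesFiniteColimits c.F := by
  have key : (∀ S : ShortComplex B, S.ShortExact → (S.map c.F).Exact ∧ Epi (c.F.map S.g)) ↔
      PreservesFiniteColimits c.F := (Functor.preservesFiniteColimits_tfae c.F).out 0 3
  rw [← key]
  intro S hS
  obtain ⟨h1, h2⟩ := (c.l ⋙ c.e).map_exact_and_epi S ⟨hS.exact, hS.epi_g⟩
  have h2' : Epi (c.e.map (c.l.map S.g)) := h2
  constructor
  · rw [ShortComplex.exact_iff_exact_up_to_refinements]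
    intro T (x : T ⟶ c.F.obj S.X₂) (hx : x ≫ c.F.map S.g = 0)
    obtain ⟨T', p, hp, (y : T' ⟶ c.e.obj (c.l.obj S.X₁)), hy⟩ :=
      h1.exact_up_to_refinements (x ≫ c.κF S.X₂) (by
        change (x ≫ c.κF S.X₂) ≫ c.e.map (c.l.map S.g) = 0
        rw [Category.assoc, ← κF_naturality, reassoc_of% hx, zero_comp])
    replace hy : p ≫ x ≫ c.κF S.X₂ = y ≫ c.e.map (c.l.map S.f) := hy
    refine ⟨T', p, hp, y ≫ c.ρF S.X₁, ?_⟩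
    change p ≫ x = (y ≫ c.ρF S.X₁) ≫ c.F.map S.f
    rw [Category.assoc, ← ρF_naturality, ← reassoc_of% hy, κF_ρF, Category.comp_id]
  · have : IsSplitEpi (c.ρF S.X₃) := ⟨⟨c.κF S.X₃, c.κF_ρF S.X₃⟩⟩
    have : Epi (c.ρF S.X₂ ≫ c.F.map S.g) := by
      rw [← ρF_naturality]
      infer_instance
    exact epi_of_epi (c.ρF S.X₂) _

/-- The functors `e G` and `F e` are isomorphic on objects. -/
def eGIso (X : A) : c.e.obj (c.G.obj X) ≅ c.F.obj (c.e.obj X) where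
  -- Both objects are complements of the image of the unit in `e (l (e X))`: one is the kernel of `e
  -- ε`, the other the kernel of `σ`.
  hom := c.κ X ≫ c.ρF (c.e.obj X)
  inv := c.κF (c.e.obj X) ≫ c.ρ X
  hom_inv_id := by simp [reassoc_of% c.ρF_κF, Preadditive.sub_comp]
  inv_hom_id := by simp [reassoc_of% c.ρ_κ, Preadditive.sub_comp]

/-- The functors `e Gⁿ` and `Fⁿ e` are isomorphic on objects. -/
def ePowGIso (X : A) : ∀ n : ℕ,
    c.e.obj ((endofunctorPow c.G n).obj X) ≅ (endofunctorPow c.F n).obj (c.e.obj X)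
  | 0 => Iso.refl _
  | n + 1 => c.eGIso _ ≪≫ c.F.mapIso (ePowGIso X n)

lemma isZero_of_isZero_e {X : A} (h : IsZero (c.e.obj X)) : IsZero X := by
  rw [IsZero.iff_id_eq_zero]
  apply c.e.map_injective
  exact h.eq_of_src _ _

lemma epi_i_map {X Y : B} (f : X ⟶ Y) [Epi f] : Epi (c.i.map f) := by
  apply c.e.epi_of_epi_map
  have : Epi (c.e.map (c.i.map f) ≫ (c.θ Y).hom) := by
    rw [θ_naturality]
    infer_instance
  have h : c.e.map (c.i.map f) = (c.e.map (c.i.map f) ≫ (c.θ Y).hom) ≫ (c.θ Y).inv := by simp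
  rw [h]
  infer_instance

/-- By adjunction and `e i ≅ Id`, a lifting problem for `X` against an epimorphism `g` becomes one
for `l X` against `i g`, which is again epi. -/
lemma projective_of_l (X : B) (h : Projective (c.l.obj X)) : Projective X where
  factors {E Y} f g _ := by
    have := c.epi_i_map g
    let f' : c.l.obj X ⟶ c.i.obj Y := c.l.map (f ≫ (c.θ Y).inv) ≫ c.ε _
    have h1 : c.η X ≫ c.e.map f' = f ≫ (c.θ Y).inv := by
      simp only [f', Functor.map_comp, Category.assoc]
      rw [← c.e.map_comp_assoc, ← c.l.map_comp, ← reassoc_of% c.η_naturality]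
      simp
    refine ⟨c.η X ≫ c.e.map (Projective.factorThru f' (c.i.map g)) ≫ (c.θ E).hom, ?_⟩
    rw [Category.assoc, Category.assoc, ← θ_naturality, ← c.e.map_comp_assoc,
      Projective.factorThru_comp, reassoc_of% h1, Iso.inv_hom_id, Category.comp_id]

lemma projective_l (X : B) [Projective X] : Projective (c.l.obj X) :=
  c.adj.map_projective X inferInstance

/-- `e (l X)` is a retract of `X ⊞ F X`. -/
def retract_e_l (X : B) : Retract (c.e.obj (c.l.obj X)) (X ⊞ c.F.obj X) where
  i := biprod.lift (c.σ X) (c.ρF X)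
  r := biprod.desc (c.η X) (c.κF X)
  retract := by simp [ρF_κF]

/-- If `Q` covers `e P`, then `l Q ⟶ l (e P) ⟶ P` is epi and splits; apply `e` and decompose `e (l
Q)`. -/
lemma exists_retract_e_projective [EnoughProjectives B] (P : A) [Projective P] :
    ∃ Q : B, Projective Q ∧ Nonempty (Retract (c.e.obj P) (Q ⊞ c.F.obj Q)) := by
  let Q := Projective.over (c.e.obj P)
  let π : c.l.obj Q ⟶ P := c.l.map (Projective.π _) ≫ c.ε P
  have : Epi π := by
    have : Epi (c.l.map (Projective.π (c.e.obj P))) := inferInstance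
    exact epi_comp _ _
  let r : Retract P (c.l.obj Q) := ⟨Projective.factorThru (𝟙 P) π, π, by simp⟩
  exact ⟨Q, inferInstance, ⟨(r.map c.e).trans (c.retract_e_l Q)⟩⟩

/-- A monomorphism which is preserved by `F` is preserved by `l`. -/
lemma mono_l_map {X Y : B} (f : X ⟶ Y) [Mono f] [Mono (c.F.map f)] : Mono (c.l.map f) := by
  apply c.e.mono_of_mono_map
  rw [Preadditive.mono_iff_cancel_zero]
  intro T z hz
  -- The two components of `z` in `F X` and `X` vanish separately, since `F f` and `f` are mono.
  have h1 : z ≫ c.ρF X = 0 := by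
    rw [← cancel_mono (c.F.map f), Category.assoc, ← ρF_naturality, reassoc_of% hz]
    simp
  have h2 : z ≫ c.σ X = 0 := by
    rw [← cancel_mono f, Category.assoc, ← σ_naturality, reassoc_of% hz]
    simp
  have h3 := z ≫= c.ρF_κF X
  rw [reassoc_of% h1, Preadditive.comp_sub, reassoc_of% h2] at h3
  simpa using h3.symm

/-- The morphism `F (e X) ⟶ e X` which defines the structure of the object `X`. -/
def act (X : A) : c.F.obj (c.e.obj X) ⟶ c.e.obj X := c.κF (c.e.obj X) ≫ c.e.map (c.ε X)

/-- If there are no nonzero morphisms from `X` to objects in the image of `i`, then the structure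
morphism of `X` is an epimorphism. -/
lemma epi_act (X : A) (h : ∀ (Y : B) (f : X ⟶ c.i.obj Y), f = 0) : Epi (c.act X) := by
  let p := cokernel.π (c.act X)
  suffices hp : p = 0 from Abelian.epi_of_cokernel_π_eq_zero _ hp
  -- This morphism corresponds to `p` under the splitting. It vanishes on `G X`, because `σ`
  -- restricted to `e (G X)` factors through `act` up to sign, so it descends to a morphism from `X`
  -- to the image of `i`, which is zero.
  let f : c.l.obj (c.e.obj X) ⟶ c.i.obj (cokernel (c.act X)) :=
    c.l.map (c.θ _).inv ≫ c.ε _ ≫ c.i.map p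
  have hf : c.e.map f ≫ (c.θ _).hom = c.σ (c.e.obj X) ≫ p := by
    simp [f, σ, θ_naturality]
  have h0 : c.ι X ≫ f = 0 := by
    apply c.e.map_injective
    rw [← cancel_mono (c.θ _).hom, c.e.map_comp, Category.assoc, hf, c.e.map_zero, zero_comp]
    change c.κ X ≫ _ = 0
    have h1 := c.κ X ≫= (c.ρF_κF (c.e.obj X) =≫ c.e.map (c.ε X))
    have h2 : c.κ X ≫ c.σ _ = - c.κ X ≫ c.ρF _ ≫ c.act X := by
      rw [act]
      simp only [Category.assoc, Preadditive.sub_comp, Preadditive.comp_sub, η_ε,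
        Category.comp_id, Category.id_comp, κ_ε, zero_sub] at h1
      rw [h1]
      simp
    rw [reassoc_of% h2]
    simp [p]
  let d : X ⟶ c.i.obj (cokernel (c.act X)) := (c.shortExact_G X).gIsCokernel.desc
    (CokernelCofork.ofπ f h0)
  have hd : c.ε X ≫ d = f := (c.shortExact_G X).gIsCokernel.fac (CokernelCofork.ofπ f h0)
    WalkingParallelPair.one
  rw [h _ d, comp_zero] at hd
  rw [← hd, c.e.map_zero, zero_comp] at hf
  rw [← Category.id_comp p, ← c.η_σ, Category.assoc, ← hf, comp_zero]

/-- Nakayama's lemma for cleft extensions with nilpotent `F`. -/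
lemma isZero_of_hom_i_eq_zero (hc : IsNilpotentEndofunctor c.F) (X : A)
    (h : ∀ (Y : B) (f : X ⟶ c.i.obj Y), f = 0) : IsZero X := by
  obtain ⟨s, hs⟩ := hc
  have := c.epi_act X h
  -- Iterating `act` makes `e X` a quotient of every `Fⁿ (e X)`, and `Fˢ = 0`.
  have key : ∀ n : ℕ, ∃ f : (endofunctorPow c.F n).obj (c.e.obj X) ⟶ c.e.obj X, Epi f := by
    intro n
    induction n with
    | zero => exact ⟨𝟙 (c.e.obj X), inferInstanceAs (Epi (𝟙 (c.e.obj X)))⟩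
    | succ n ih =>
      obtain ⟨f, hf⟩ := ih
      exact ⟨c.F.map f ≫ c.act X, epi_comp (c.F.map f) (c.act X)⟩
  obtain ⟨f, hf⟩ := key s
  exact c.isZero_of_isZero_e ((hs _).of_epi f)

instance preservesFiniteColimits_endofunctorPow :
    ∀ n : ℕ, PreservesFiniteColimits (endofunctorPow c.F n)
  | 0 => inferInstanceAs (PreservesFiniteColimits (𝟭 B))
  | n + 1 => by
    have := preservesFiniteColimits_endofunctorPow n
    exact inferInstanceAs (PreservesFiniteColimits (endofunctorPow c.F n ⋙ c.F))

end CleftExtension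

namespace CategoryTheory

/-! ### Finite projective dimension detected in the singularity category -/

section Singularity

attribute [local instance] HasDerivedCategory.standard

variable (A : Type u) [Category.{v} A] [Abelian A]

open Pretriangulated ZeroObject

/-- The objects `X` of the derived category such that `Hom(X, Y[n]) = 0` for all objects `Y` of the
abelian category and all large enough `n`. -/
def boundedExt : ObjectProperty (DerivedCategory A) := fun X =>
  ∃ N : ℤ, ∀ n : ℤ, N ≤ n → ∀ (Y : A)
    (f : X ⟶ ((DerivedCategory.singleFunctor A 0).obj Y)⟦n⟧), f = 0

variable {A}

lemma boundedExt_of_retract {X X' : DerivedCategory A} (r : Retract X X') (h : boundedExt A X') :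
    boundedExt A X := by
  obtain ⟨N, hN⟩ := h
  refine ⟨N, fun n hn Y f => ?_⟩
  rw [← Category.id_comp f, ← r.retract, Category.assoc, hN n hn Y (r.r ≫ f), comp_zero]

instance : (boundedExt A).IsClosedUnderIsomorphisms where
  of_iso e h := boundedExt_of_retract e.symm.retract h

/-- A triangulated subcategory gives a calculus of fractions, so equalities in the quotient by
`boundedExt` can be tested on actual morphisms. -/
instance : (boundedExt A).IsTriangulated where
  exists_zero := ⟨0, isZero_zero _, 0, fun _ _ _ _ => (isZero_zero _).eq_of_src _ _⟩
  isStableUnderShiftBy a := ⟨by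
    rintro X ⟨N, hN⟩
    refine ⟨N + a, fun n hn Y f => ?_⟩
    have e := (shiftFunctorAdd' (DerivedCategory A) (n - a) a n (by lia)).app
      ((DerivedCategory.singleFunctor A 0).obj Y)
    obtain ⟨g, hg⟩ := (shiftFunctor (DerivedCategory A) a).map_surjective (f ≫ e.hom)
    rw [hN (n - a) (by lia) Y g, Functor.map_zero] at hg
    rw [← cancel_mono e.hom, ← hg, zero_comp]⟩
  toIsTriangulatedClosed₂ := .mk' (by
    rintro T hT ⟨N, hN⟩ ⟨M, hM⟩
    refine ⟨max N M, fun n hn Y f => ?_⟩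
    obtain ⟨g, rfl⟩ := Triangle.yoneda_exact₂ T hT f (hN n (by lia) Y _)
    rw [hM n (by lia) Y g, comp_zero])

/-- A bounded complex `K` of projectives is K-projective, so morphisms out of it in the derived
category are represented by chain maps. Since `Y[n]` lives in degree `-n`, below `a` once `n ≥ 1 -
a`, such a chain map is zero. -/
lemma perfectObjects_le :
    perfectObjects A ≤ (boundedExt A).inverseImage DerivedCategory.Bounded.ι := by
  rintro X ⟨K, hK, ⟨a, ha⟩, ⟨b, hb⟩, ⟨e⟩⟩
  refine boundedExt_of_retract e.retract ⟨1 - a, fun n hn Y f => ?_⟩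
  let L : CochainComplex A ℤ := (CochainComplex.singleFunctor A (-n)).obj Y
  let e' : DerivedCategory.Q.obj L ≅ ((DerivedCategory.singleFunctor A 0).obj Y)⟦n⟧ :=
    (DerivedCategory.singleFunctorIsoCompQ A (-n)).symm.app Y ≪≫
      (((DerivedCategory.singleFunctors A).shiftIso n (-n) 0 (by lia)).app Y).symm
  have : K.IsKProjective := K.isKProjective_of_projective b
  have hKL : ∀ g : K ⟶ L, g = 0 := by
    intro g
    ext i
    by_cases hi : i < a
    · exact (K.isZero_of_isStrictlyGE a i hi).eq_of_src _ _
    · exact (HomologicalComplex.isZero_single_obj_X (ComplexShape.up ℤ) (-n) Y i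
        (by lia)).eq_of_tgt _ _
  let ψ := DerivedCategory.quotientCompQhIso A
  obtain ⟨g, hg⟩ := (CochainComplex.IsKProjective.Qh_map_bijective K
    ((HomotopyCategory.quotient A (ComplexShape.up ℤ)).obj L)).surjective
      (ψ.hom.app K ≫ f ≫ e'.inv ≫ ψ.inv.app L)
  obtain ⟨g, rfl⟩ := (HomotopyCategory.quotient A (ComplexShape.up ℤ)).map_surjective g
  rw [hKL g, Functor.map_zero, Functor.map_zero] at hg
  rw [← cancel_epi (ψ.hom.app K), ← cancel_mono (e'.inv ≫ ψ.inv.app L)]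
  simpa using hg.symm

lemma hasFiniteProjectiveDimension_of_boundedExt {X : A}
    (h : boundedExt A ((DerivedCategory.singleFunctor A 0).obj X)) :
    HasFiniteProjectiveDimension X := by
  obtain ⟨N, hN⟩ := h
  refine ⟨N.toNat, ?_⟩
  let := HasExt.standard A
  refine HasProjectiveDimensionLT.mk fun i hi Y e => ?_
  apply Abelian.Ext.homEquiv.injective
  rw [hN i (by lia) Y (Abelian.Ext.homEquiv e)]
  symm
  exact hN i (by lia) Y _

/-- An object of `A` which becomes isomorphic to a projective object in the singularity category
has finite projective dimension. -/
lemma hasFiniteProjectiveDimension_of_iso {X P : A} [Projective P]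
    (φ : (toSingularity A).obj X ≅ (toSingularity A).obj P) : HasFiniteProjectiveDimension X := by
  -- In the coarser quotient by `Z` the object `P` vanishes, hence so does `X`. A roof then gives a
  -- zero morphism `s` into `X` with cone in `Z`; its triangle makes `X` a retract of that cone.
  let Z := (boundedExt A).inverseImage DerivedCategory.Bounded.ι
  let W := Z.trW
  have hW : (perfectObjects A).trW.IsInvertedBy W.Q := fun _ _ s hs =>
    W.Q_inverts s (ObjectProperty.trW_monotone perfectObjects_le _ hs)
  let Φ : SingularityCategory A ⥤ W.Localization := Localization.Construction.lift W.Q hW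
  have hΦ : toSingularity A ⋙ Φ = toBounded A ⋙ W.Q :=
    congrArg (fun G => toBounded A ⋙ G) (Localization.Construction.fac W.Q hW)
  have hP : IsZero (W.Q.obj ((toBounded A).obj P)) := by
    have h1 : W (contractibleTriangle ((toBounded A).obj P)).mor₂ :=
      ObjectProperty.trW.mk' Z (contractible_distinguished _)
        (perfectObjects_le _ (toBounded_perfect P))
    have h2 := W.Q_inverts _ h1
    exact (W.Q.map_isZero (isZero_zero _)).of_iso (@asIso _ _ _ _ _ h2)
  have hX : IsZero (W.Q.obj ((toBounded A).obj X)) :=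
    hP.of_iso ((eqToIso hΦ).symm.app X ≪≫ Φ.mapIso φ ≪≫ (eqToIso hΦ).app P)
  have h1 : W.Q.map (𝟙 ((toBounded A).obj X)) = W.Q.map 0 := hX.eq_of_src _ _
  rw [MorphismProperty.map_eq_iff_precomp W.Q W] at h1
  obtain ⟨T, s, ⟨Y, g, h, hT, hY⟩, h2⟩ := h1
  rw [Category.comp_id, comp_zero] at h2
  obtain ⟨r, hr⟩ := Triangle.yoneda_exact₂ _ hT (𝟙 ((toBounded A).obj X)) (by
    change s ≫ _ = 0
    rw [h2, zero_comp])
  exact hasFiniteProjectiveDimension_of_boundedExt (boundedExt_of_retract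
    (Retract.map ⟨g, r, hr.symm⟩ DerivedCategory.Bounded.ι) hY)

end Singularity
end CategoryTheory

/-! ### Gorenstein projectives as families of short exact sequences -/

/-- A family of short exact sequences `Z n ⟶ P n ⟶ Z (n + 1)` with projective middle terms, such
that all morphisms from `Z n` to projective objects extend to `P n`. -/
structure TotalSyzygies (A : Type u) [Category.{v} A] [Abelian A] where
  Z : ℤ → A
  P : ℤ → A
  f (n : ℤ) : Z n ⟶ P n
  g (n : ℤ) : P n ⟶ Z (n + 1)
  w (n : ℤ) : f n ≫ g n = 0
  shortExact (n : ℤ) : (ShortComplex.mk (f n) (g n) (w n)).ShortExact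
  projective (n : ℤ) : Projective (P n)
  extend (n : ℤ) (Q : A) (_ : Projective Q) (a : Z n ⟶ Q) : ∃ b : P n ⟶ Q, f n ≫ b = a

section

variable {A : Type u} [Category.{v} A] [Abelian A]

lemma IsTotallyAcyclic.epi_lift {K : CochainComplex A ℤ} (hK : IsTotallyAcyclic K) {i j k : ℤ}
    (hij : i + 1 = j) (hjk : j + 1 = k) :
    Epi (kernel.lift (K.d j k) (K.d i j) (K.d_comp_d i j k)) := by
  have h := hK.acyclic j
  rw [HomologicalComplex.exactAt_iff' K i j k (by simp; lia) (by simp; lia)] at h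
  exact (ShortComplex.exact_iff_epi_kernel_lift _).1 h

/-- The syzygies of a totally acyclic complex. -/
def IsTotallyAcyclic.totalSyzygies {K : CochainComplex A ℤ} (hK : IsTotallyAcyclic K) :
    TotalSyzygies A where
  Z n := kernel (K.d n (n + 1))
  P n := K.X n
  f n := kernel.ι _
  g n := kernel.lift _ (K.d n (n + 1)) (K.d_comp_d _ _ _)
  w n := by
    rw [← cancel_mono (kernel.ι _)]
    simp
  shortExact n := by
    refine ShortComplex.ShortExact.mk' ?_ (inferInstanceAs (Mono (kernel.ι _)))
      (hK.epi_lift rfl rfl)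
    let φ : ShortComplex.mk (kernel.ι (K.d n (n + 1)))
        (kernel.lift (K.d (n + 1) (n + 1 + 1)) (K.d n (n + 1)) (K.d_comp_d _ _ _)) (by
          rw [← cancel_mono (kernel.ι _)]
          simp) ⟶ ShortComplex.mk (kernel.ι (K.d n (n + 1))) (K.d n (n + 1))
            (kernel.condition _) :=
      { τ₁ := 𝟙 _, τ₂ := 𝟙 _, τ₃ := kernel.ι _ }
    have : Epi φ.τ₁ := inferInstanceAs (Epi (𝟙 _))
    have : IsIso φ.τ₂ := inferInstanceAs (IsIso (𝟙 _))
    have : Mono φ.τ₃ := inferInstanceAs (Mono (kernel.ι _))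
    exact (ShortComplex.exact_iff_of_epi_of_isIso_of_mono φ).2 (ShortComplex.exact_kernel _)
  projective n := hK.projective n
  extend n Q hQ a := by
    obtain ⟨m, rfl⟩ : ∃ m, n = m + 1 := ⟨n - 1, by lia⟩
    have := hK.epi_lift (i := m) rfl rfl
    -- Precomposing `a` with the epimorphism from `K.X m` onto the cocycles gives a cocycle of
    -- `Hom(K, Q)`.
    obtain ⟨b, hb⟩ := hK.hom_acyclic Q hQ m
      (kernel.lift (K.d (m + 1) (m + 1 + 1)) (K.d m (m + 1)) (K.d_comp_d _ _ _) ≫ a) (by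
        rw [← Category.assoc]
        convert zero_comp
        rw [← cancel_mono (kernel.ι _)]
        simp)
    refine ⟨b, ?_⟩
    rw [← cancel_epi (kernel.lift (K.d (m + 1) (m + 1 + 1)) (K.d m (m + 1)) (K.d_comp_d _ _ _)),
      ← hb, kernel.lift_ι_assoc]

namespace TotalSyzygies

variable (T : TotalSyzygies A)

instance (n : ℤ) : Mono (T.f n) := (T.shortExact n).mono_f

instance (n : ℤ) : Epi (T.g n) := (T.shortExact n).epi_g

/-- The complex obtained by splicing the short exact sequences `Z n ⟶ P n ⟶ Z (n + 1)`. -/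
def complex : CochainComplex A ℤ :=
  CochainComplex.of T.P (fun n => T.g n ≫ T.f (n + 1)) (fun n => by
    rw [Category.assoc, ← Category.assoc (T.f _), T.w, zero_comp, comp_zero])

lemma complex_d (n : ℤ) : T.complex.d n (n + 1) = T.g n ≫ T.f (n + 1) :=
  CochainComplex.of_d T.P (fun n => T.g n ≫ T.f (n + 1)) n

lemma isTotallyAcyclic_complex : IsTotallyAcyclic T.complex where
  projective n := T.projective n
  acyclic n := by
    obtain ⟨m, rfl⟩ : ∃ m, n = m + 1 := ⟨n - 1, by lia⟩
    rw [HomologicalComplex.exactAt_iff' _ m (m + 1) (m + 1 + 1) (by simp) (by simp)]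
    have h1 : (ShortComplex.mk (T.g m ≫ T.f (m + 1)) (T.g (m + 1)) (by
        rw [Category.assoc, T.w, comp_zero])).Exact := by
      let φ : ShortComplex.mk (T.g m ≫ T.f (m + 1)) (T.g (m + 1)) (by
          rw [Category.assoc, T.w, comp_zero]) ⟶
          ShortComplex.mk (T.f (m + 1)) (T.g (m + 1)) (T.w _) :=
        { τ₁ := T.g m, τ₂ := 𝟙 _, τ₃ := 𝟙 _ }
      have : Epi φ.τ₁ := inferInstanceAs (Epi (T.g m))
      have : IsIso φ.τ₂ := inferInstanceAs (IsIso (𝟙 _))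
      have : Mono φ.τ₃ := inferInstanceAs (Mono (𝟙 _))
      exact (ShortComplex.exact_iff_of_epi_of_isIso_of_mono φ).2 (T.shortExact (m + 1)).exact
    let φ : ShortComplex.mk (T.g m ≫ T.f (m + 1)) (T.g (m + 1)) (by
        rw [Category.assoc, T.w, comp_zero]) ⟶ T.complex.sc' m (m + 1) (m + 1 + 1) :=
      { τ₁ := 𝟙 (T.P m), τ₂ := 𝟙 (T.P (m + 1)), τ₃ := T.f (m + 1 + 1)
        comm₁₂ := (Category.id_comp _).trans ((T.complex_d m).trans (Category.comp_id _).symm)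
        comm₂₃ := (Category.id_comp _).trans (T.complex_d (m + 1)) }
    have : Epi φ.τ₁ := inferInstanceAs (Epi (𝟙 _))
    have : IsIso φ.τ₂ := inferInstanceAs (IsIso (𝟙 _))
    have : Mono φ.τ₃ := inferInstanceAs (Mono (T.f _))
    exact (ShortComplex.exact_iff_of_epi_of_isIso_of_mono φ).1 h1
  hom_acyclic Q hQ n (f : T.P n ⟶ Q) h := by
    obtain ⟨m, rfl⟩ : ∃ m, n = m + 1 := ⟨n - 1, by lia⟩
    have hm : m + 1 - 1 = m := by lia
    rw [hm] at h
    have h' : (T.g m ≫ T.f (m + 1)) ≫ f = 0 := (congrArg (· ≫ f) (T.complex_d m).symm).trans h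
    have h0 : T.f (m + 1) ≫ f = 0 := by
      rw [← cancel_epi (T.g m), ← Category.assoc, h', comp_zero]
    let a : T.Z (m + 1 + 1) ⟶ Q := (T.shortExact (m + 1)).gIsCokernel.desc
      (CokernelCofork.ofπ f h0)
    have ha : T.g (m + 1) ≫ a = f := (T.shortExact (m + 1)).gIsCokernel.fac
      (CokernelCofork.ofπ f h0) WalkingParallelPair.one
    obtain ⟨b, hb⟩ := T.extend _ Q hQ a
    refine ⟨b, (congrArg (· ≫ b) (T.complex_d (m + 1))).trans ?_⟩
    rw [← ha, ← hb]
    exact Category.assoc _ _ _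

lemma gorensteinProjective_Z : gorensteinProjective A (T.Z 0) := by
  let p : T.complex.X (-1) ⟶ T.Z 0 := T.g (-1)
  have : Epi p := inferInstanceAs (Epi (T.g (-1)))
  have := strongEpi_of_epi p
  have : Mono (show T.Z 0 ⟶ T.complex.X 0 from T.f 0) := inferInstanceAs (Mono (T.f 0))
  exact ⟨T.complex, T.isTotallyAcyclic_complex,
    ⟨image.isoStrongEpiMono p (show T.Z 0 ⟶ T.complex.X 0 from T.f 0) (T.complex_d (-1)).symm⟩⟩

end TotalSyzygies

lemma gorensteinProjective_of_iso {X Y : A} (e : X ≅ Y) (h : gorensteinProjective A X) :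
    gorensteinProjective A Y := by
  obtain ⟨K, hK, ⟨e'⟩⟩ := h
  exact ⟨K, hK, ⟨e.symm ≪≫ e'⟩⟩

/-- Acyclicity identifies the image of `d⁻¹` with the kernel of `d⁰`. In this form a functor can be
applied to the sequences one at a time. -/
lemma gorensteinProjective_iff (X : A) :
    gorensteinProjective A X ↔ ∃ T : TotalSyzygies A, Nonempty (X ≅ T.Z 0) := by
  constructor
  · rintro ⟨K, hK, ⟨e⟩⟩
    have := hK.epi_lift (show (-1 : ℤ) + 1 = 0 from rfl) (show (0 : ℤ) + 1 = 1 from rfl)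
    have := strongEpi_of_epi (kernel.lift (K.d 0 1) (K.d (-1) 0) (K.d_comp_d _ _ _))
    refine ⟨hK.totalSyzygies, ⟨e ≪≫ (image.isoStrongEpiMono
      (kernel.lift (K.d 0 1) (K.d (-1) 0) (K.d_comp_d _ _ _)) (kernel.ι _)
      (kernel.lift_ι _ _ _)).symm⟩⟩
  · rintro ⟨T, ⟨e⟩⟩
    exact gorensteinProjective_of_iso e.symm T.gorensteinProjective_Z

lemma gorensteinProjective_of_projective (X : A) [Projective X] : gorensteinProjective A X := by
  have hS := (ShortComplex.Splitting.ofHasBinaryBiproduct X X).shortExact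
  exact (gorensteinProjective_iff X).2 ⟨{
    Z := fun _ => X
    P := fun _ => X ⊞ X
    f := fun _ => biprod.inl
    g := fun _ => biprod.snd
    w := fun _ => by simp
    shortExact := fun _ => hS
    projective := fun _ => inferInstance
    extend := fun _ Q _ a => ⟨biprod.desc a 0, by simp⟩ }, ⟨Iso.refl _⟩⟩

end

/-! ### Acyclicity of cosyzygies and descent of finite projective dimension along `e` -/

namespace CategoryTheory

/-- Lifts to resolutions add up. Additivity lets derived functors be evaluated on `Q ⊞ F Q`. -/
instance Functor.leftDerived_additive {C : Type u} [Category.{v} C] [Abelian C] {D : Type u'}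
    [Category.{v'} D] [Abelian D] [HasProjectiveResolutions C] (T : C ⥤ D) [T.Additive] (n : ℕ) :
    (T.leftDerived n).Additive where
  map_add {X Y f g} := by
    let R := projectiveResolution X
    let S := projectiveResolution Y
    have hf := ProjectiveResolution.lift_commutes f R S
    have hg := ProjectiveResolution.lift_commutes g R S
    rw [T.leftDerived_map_eq n f _ hf, T.leftDerived_map_eq n g _ hg,
      T.leftDerived_map_eq n (f + g)
        (ProjectiveResolution.lift f R S + ProjectiveResolution.lift g R S) (by
          rw [Preadditive.add_comp, hf, hg, Functor.map_add, Preadditive.comp_add]),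
      Functor.map_add, Preadditive.add_comp, Preadditive.comp_add]

section SyzygyFlat

variable {C : Type u} [Category.{v} C] [Abelian C] {D : Type u'} [Category.{v'} D] [Abelian D]

lemma SyzygyFlat.of_preservesMonomorphisms {D : Type u'} [Category.{v'} D] (T : C ⥤ D)
    [T.PreservesMonomorphisms] (n : ℕ) (X : C) :
    SyzygyFlat T n X := by
  induction n generalizing X with
  | zero =>
    intro K P f g w hS hP
    have : Mono f := hS.mono_f
    infer_instance
  | succ n ih => exact fun K P f g w hS hP => ih K

/-- Dimension shifting along an unbounded sequence of cosyzygies. -/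
lemma SyzygyFlat.of_cosyzygies [EnoughProjectives C] (T : C ⥤ D) [T.Additive]
    [PreservesFiniteColimits T] (N : ℕ) (hT : ∀ n X, N ≤ n → SyzygyFlat T n X)
    {Z P : ℤ → C} {f : ∀ k, Z k ⟶ P k} {g : ∀ k, P k ⟶ Z (k + 1)} {w : ∀ k, f k ≫ g k = 0}
    (hS : ∀ k, (ShortComplex.mk (f k) (g k) (w k)).ShortExact)
    (hP : ∀ n k, SyzygyFlat T n (P k)) (n : ℕ) (k : ℤ) : SyzygyFlat T n (Z k) := by
  -- Induction on the distance `d` to the range `n ≥ N`: level `n` at `Z k` follows from level `n +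
  -- 1` at `Z (k + 1)`.
  suffices ∀ d n k, N ≤ n + d → SyzygyFlat T n (Z k) from this N n k (by lia)
  intro d
  induction d with
  | zero => exact fun n k h => hT _ _ h
  | succ d ih => exact fun n k h => .X₁ n (hS k) (hP n k) (ih (n + 1) (k + 1) (by lia))

end SyzygyFlat

end CategoryTheory

/-- The functors `Fⁿ F` and `F Fⁿ` are isomorphic on objects. -/
def endofunctorPowIso {B : Type u} [Category.{v} B] (F : B ⥤ B) (X : B) : ∀ n : ℕ,
    (endofunctorPow F n).obj (F.obj X) ≅ (endofunctorPow F (n + 1)).obj X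
  | 0 => Iso.refl _
  | n + 1 => F.mapIso (endofunctorPowIso F X n)

namespace CleftExtension

variable {B : Type u} [Category.{v} B] [Abelian B] {A : Type u'} [Category.{v'} A] [Abelian A]
  (c : CleftExtension B A)

/-- Applied with `T = F^q`, this trades acyclicity for `F^q` and `F^(q+1)` for acyclicity for `l
F^q`, by `mono_l_map`. -/
lemma syzygyFlat_comp_l {C : Type w} [Category.{v} C] [Abelian C] {T : C ⥤ B} (n : ℕ) {X : C}
    (h : SyzygyFlat T n X) (h' : SyzygyFlat (T ⋙ c.F) n X) : SyzygyFlat (T ⋙ c.l) n X := by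
  induction n generalizing X with
  | zero =>
    intro K P f g w hS hP
    have := h f g w hS hP
    have : Mono (c.F.map (T.map f)) := h' f g w hS hP
    exact c.mono_l_map (T.map f)
  | succ n ih => exact fun K P f g w hS hP => ih (h f g w hS hP) (h' f g w hS hP)

variable [EnoughProjectives B] (hc : IsPerfectEndofunctor c.F)

include hc

lemma syzygyFlat_F_obj (q n : ℕ) (P : B) [Projective P] :
    SyzygyFlat (endofunctorPow c.F q) n (c.F.obj P) := by
  cases q with
  | zero =>
    have : (endofunctorPow c.F 0).PreservesMonomorphisms :=
      inferInstanceAs (𝟭 B).PreservesMonomorphisms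
    exact .of_preservesMonomorphisms _ _ _
  | succ q =>
    exact .of_isZero_leftDerived _ _ (hc.condR (n + 1) (q + 1) (by lia) (by lia) P inferInstance)

/-- `e P` is a retract of `Q ⊞ F Q`; positive derived functors vanish on the projective `Q`, and
`condR` handles `F Q`. -/
lemma syzygyFlat_e_obj (q n : ℕ) (P : A) [Projective P] :
    SyzygyFlat (endofunctorPow c.F q) n (c.e.obj P) := by
  cases q with
  | zero =>
    have : (endofunctorPow c.F 0).PreservesMonomorphisms :=
      inferInstanceAs (𝟭 B).PreservesMonomorphisms
    exact .of_preservesMonomorphisms _ _ _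
  | succ q =>
    obtain ⟨Q, hQ, ⟨r⟩⟩ := c.exists_retract_e_projective P
    let T := (endofunctorPow c.F (q + 1)).leftDerived (n + 1)
    have : PreservesBinaryBiproducts T := preservesBinaryBiproducts_of_preservesBiproducts T
    have h : IsZero (T.obj (Q ⊞ c.F.obj Q)) :=
      ((biprod_isZero_iff _ _).2 ⟨Functor.isZero_leftDerived_obj_projective_succ _ n Q,
        hc.condR (n + 1) (q + 1) (by lia) (by lia) Q hQ⟩).of_iso (T.mapBiprod Q (c.F.obj Q))
    exact .of_isZero_leftDerived _ _ (h.of_mono (r.map T).i)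

lemma syzygyFlat_cosyzygies {Z P : ℤ → B} {f : ∀ k, Z k ⟶ P k} {g : ∀ k, P k ⟶ Z (k + 1)}
    {w : ∀ k, f k ≫ g k = 0} (hS : ∀ k, (ShortComplex.mk (f k) (g k) (w k)).ShortExact) (q : ℕ)
    (hP : ∀ n k, SyzygyFlat (endofunctorPow c.F q) n (P k)) (n : ℕ) (k : ℤ) :
    SyzygyFlat (endofunctorPow c.F q) n (Z k) := by
  cases q with
  | zero =>
    have : (endofunctorPow c.F 0).PreservesMonomorphisms :=
      inferInstanceAs (𝟭 B).PreservesMonomorphisms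
    exact .of_preservesMonomorphisms _ _ _
  | succ q =>
    obtain ⟨N, hN⟩ := hc.vanishing
    exact .of_cosyzygies _ N (fun n X h => .of_isZero_leftDerived _ _
      (hN (n + 1) (q + 1) (by lia) (by lia) (by lia) X)) hS hP n k

/-- Write `F^(q+1) P` as `F^q (F P)`. The object `F P` has finite projective dimension and is
acyclic for `l F^q`, which by induction sends projectives to objects of finite projective dimension.
-/
lemma hasFiniteProjectiveDimension_l_pow (q : ℕ) (P : B) [Projective P] :
    HasFiniteProjectiveDimension (c.l.obj ((endofunctorPow c.F q).obj P)) := by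
  induction q generalizing P with
  | zero =>
    have := c.projective_l P
    exact .of_projective (c.l.obj P)
  | succ q ih =>
    have hF : HasFiniteProjectiveDimension (c.F.obj P) := by
      obtain ⟨n, hn⟩ := hc.finite_pd P inferInstance
      exact ⟨n + 1, hn⟩
    refine (hF.map (endofunctorPow c.F q ⋙ c.l) (fun P hP => ih P) (fun n =>
      ?_)).of_retract (c.l.mapIso (endofunctorPowIso c.F P q).symm).retract
    exact c.syzygyFlat_comp_l n (c.syzygyFlat_F_obj hc q n P) (c.syzygyFlat_F_obj hc (q + 1) n P)

/-- Descending induction on `q` along `0 → G^(q+1) X → l (e (G^q X)) → G^q X → 0`, starting from `Gˢ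
X = 0`. The middle term is `l (F^q (e X))`, of finite projective dimension by acyclicity. -/
lemma hasFiniteProjectiveDimension_of_e (hn : IsNilpotentEndofunctor c.F) (X : A)
    (h : ∀ q n, SyzygyFlat (endofunctorPow c.F q) n (c.e.obj X))
    (hX : HasFiniteProjectiveDimension (c.e.obj X)) : HasFiniteProjectiveDimension X := by
  obtain ⟨s, hs⟩ := hn
  suffices ∀ d q, q + d = s → HasFiniteProjectiveDimension ((endofunctorPow c.G q).obj X) from
    this s 0 (by lia)
  intro d
  induction d with
  | zero =>
    rintro q rfl
    exact .of_isZero (c.isZero_of_isZero_e ((hs _).of_iso (c.ePowGIso X q)))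
  | succ d ih =>
    intro q hq
    refine .X₃ (c.shortExact_G _) (ih (q + 1) (by lia)) ?_
    refine (hX.map (endofunctorPow c.F q ⋙ c.l)
      (fun P hP => c.hasFiniteProjectiveDimension_l_pow hc q P) (fun n => ?_)).of_retract
        (c.l.mapIso (c.ePowGIso X q)).retract
    exact c.syzygyFlat_comp_l n (h q n) (h (q + 1) n)

end CleftExtension

namespace CleftExtension

variable {B : Type u} [Category.{v} B] [Abelian B] {A : Type u'} [Category.{v'} A] [Abelian A]
  (c : CleftExtension B A) [EnoughProjectives B]

lemma hasFiniteProjectiveDimension_cosyzygies (hc : IsPerfectEndofunctor c.F)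
    (hn : IsNilpotentEndofunctor c.F) {Z P : ℤ → A} {f : ∀ k, Z k ⟶ P k}
    {g : ∀ k, P k ⟶ Z (k + 1)} {w : ∀ k, f k ≫ g k = 0}
    (hS : ∀ k, (ShortComplex.mk (f k) (g k) (w k)).ShortExact) (hP : ∀ k, Projective (P k)) (k : ℤ)
    (hZ : HasFiniteProjectiveDimension (c.e.obj (Z k))) : HasFiniteProjectiveDimension (Z k) :=
  c.hasFiniteProjectiveDimension_of_e hc hn (Z k) (fun q n =>
    c.syzygyFlat_cosyzygies hc (Z := fun k => c.e.obj (Z k)) (P := fun k => c.e.obj (P k))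
      (fun k => (hS k).map_of_exact c.e) q (fun n k => c.syzygyFlat_e_obj hc q n (P k)) n k) hZ

end CleftExtension

/-! ### Finitely generated modules and statement (ii) -/

namespace FGRightMod

variable {R : Type u} [Ring R] [IsNoetherianRing Rᵐᵒᵖ]

instance : PreservesFiniteLimits (incl R) :=
  inferInstanceAs (PreservesFiniteLimits (forget₂ (FGModuleCat Rᵐᵒᵖ) (ModuleCat Rᵐᵒᵖ)))

instance : PreservesFiniteColimits (incl R) :=
  inferInstanceAs (PreservesFiniteColimits (forget₂ (FGModuleCat Rᵐᵒᵖ) (ModuleCat Rᵐᵒᵖ)))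

lemma projective_of_incl {X : FGRightMod R} (h : Projective ((incl R).obj X)) : Projective X where
  factors {E Y} f g _ := by
    obtain ⟨a, ha⟩ := (incl R).map_surjective (Projective.factorThru ((incl R).map f)
      ((incl R).map g))
    refine ⟨a, (incl R).map_injective ?_⟩
    rw [Functor.map_comp, ha, Projective.factorThru_comp]

end FGRightMod

section

variable {R : Type u} [Ring R] [IsNoetherianRing Rᵐᵒᵖ]

/-- Passing from `Z (k + 1)` to `Z k` lowers the projective dimension, so by induction `Z k` is
projective. Its identity then extends to `P k`, the sequence splits, and `Z (k + 1)` is a summand of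
`P k`. -/
lemma TotalSyzygies.projective_Z (T : TotalSyzygies (FGRightMod R)) (n : ℤ)
    (h : HasFiniteProjectiveDimension ((FGRightMod.incl R).obj (T.Z n))) : Projective (T.Z n) := by
  suffices ∀ (m : ℕ) (n : ℤ), HasProjectiveDimensionLT ((FGRightMod.incl R).obj (T.Z n)) (m + 1) →
      Projective (T.Z n) by
    obtain ⟨m, hm⟩ := h
    exact this m n (hasProjectiveDimensionLT_of_ge _ m _ (by lia))
  intro m
  induction m with
  | zero => exact fun n h =>
      FGRightMod.projective_of_incl (projective_iff_hasProjectiveDimensionLT_one.2 h)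
  | succ m ih =>
    intro n h
    obtain ⟨k, rfl⟩ : ∃ k, n = k + 1 := ⟨n - 1, by lia⟩
    have hS := (T.shortExact k).map_of_exact (FGRightMod.incl R)
    have := T.projective k
    have hk := ih k
      ((hS.hasProjectiveDimensionLT_X₃_iff m (FGRightMod.projective_incl (T.P k))).1 h)
    obtain ⟨r, hr⟩ := T.extend k _ hk (𝟙 _)
    let s := ShortComplex.Splitting.ofExactOfRetraction _ (T.shortExact k).exact r hr
      (T.shortExact k).epi_g
    exact Retract.projective (Y := T.P k) ⟨s.s, T.g k, s.s_g⟩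

variable {S : Type u} [Ring S] [IsNoetherianRing Sᵐᵒᵖ]

theorem IsCMFree.of_inducesStableFunctor (c : CleftExtension (RightMod R) (RightMod S))
    (hperf : IsPerfectEndofunctor c.F) (hnil : IsNilpotentEndofunctor c.F)
    (he : InducesStableFunctor c.e) (hR : IsCMFree R) : IsCMFree S := by
  refine fun X => ⟨fun hX => ?_, fun _ => gorensteinProjective_of_projective X⟩
  obtain ⟨T, ⟨φ⟩⟩ := (gorensteinProjective_iff X).1 hX
  obtain ⟨E, ⟨ψ⟩⟩ := he
  let Z : Gproj S := ⟨T.Z 0, T.gorensteinProjective_Z⟩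
  -- `Y` represents the value of the induced functor; being projective, it makes `e X` isomorphic to
  -- a projective in the singularity category.
  let Y : Gproj R := (E.obj ((toStableGProj _).obj Z)).as
  have : Projective Y.obj := (hR Y.obj).1 Y.property
  have := FGRightMod.projective_incl Y.obj
  let χ : (toSingularity _).obj ((FGRightMod.incl R).obj Y.obj) ≅
    (toSingularity _).obj (c.e.obj ((FGRightMod.incl S).obj (T.Z 0))) := ψ.app Z
  have h := c.hasFiniteProjectiveDimension_cosyzygies hperf hnil
    (Z := fun k => (FGRightMod.incl S).obj (T.Z k))
    (P := fun k => (FGRightMod.incl S).obj (T.P k))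
    (fun k => (T.shortExact k).map_of_exact (FGRightMod.incl S))
    (fun k => by
      have := T.projective k
      exact FGRightMod.projective_incl (T.P k)) 0 (hasFiniteProjectiveDimension_of_iso χ.symm)
  have := T.projective_Z 0 h
  exact .of_iso φ.symm this

end

/-! ### Finite projective dimension of `e P`, and finite generation of `l X` -/

namespace CleftExtension

section

variable {B : Type u} [Category.{v} B] [Abelian B] {A : Type u'} [Category.{v'} A] [Abelian A]
  (c : CleftExtension B A)

lemma hasFiniteProjectiveDimension_e [EnoughProjectives B] (hc : IsPerfectEndofunctor c.F) (P : A)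
    [Projective P] : HasFiniteProjectiveDimension (c.e.obj P) := by
  obtain ⟨Q, hQ, ⟨r⟩⟩ := c.exists_retract_e_projective P
  have hF : HasFiniteProjectiveDimension (c.F.obj Q) := by
    obtain ⟨n, hn⟩ := hc.finite_pd Q hQ
    exact ⟨n + 1, hn⟩
  exact (HasFiniteProjectiveDimension.X₂
    (ShortComplex.Splitting.ofHasBinaryBiproduct Q (c.F.obj Q)).shortExact
    (.of_projective Q) hF).of_retract r

/-- The natural epimorphism `l X ⟶ i X`. -/
def δ (X : B) : c.l.obj X ⟶ c.i.obj X := c.l.map (c.θ X).inv ≫ c.ε (c.i.obj X)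

instance epi_δ (X : B) : Epi (c.δ X) := by
  unfold δ
  infer_instance

/-- All morphisms from `l X` to the image of `i` factor through `l X ⟶ i X`. -/
lemma exists_δ_comp {X Y : B} (f : c.l.obj X ⟶ c.i.obj Y) : ∃ u : X ⟶ Y, c.δ X ≫ c.i.map u = f := by
  refine ⟨c.η X ≫ c.e.map f ≫ (c.θ Y).hom, ?_⟩
  rw [δ, Category.assoc, ← ε_naturality, ← Category.assoc, ← c.l.map_comp, ← θ_inv_naturality]
  simp only [Category.assoc, Iso.hom_inv_id, Category.comp_id, Functor.map_comp, ε_naturality]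
  have h : c.l.map (c.η X) ≫ c.ε (c.l.obj X) = 𝟙 _ := c.adj.left_triangle_components X
  rw [reassoc_of% h]

end

section Modules

variable {R S : Type u} [Ring R] [Ring S] (c : CleftExtension (RightMod R) (RightMod S))

/-- Sending a submodule `V` to the image of `e V` is strictly monotone, since `e` is exact and
reflects epimorphisms; the ascending chain condition pulls back. -/
lemma isNoetherian_of_e (X : RightMod S) [h : IsNoetherian Rᵐᵒᵖ (c.e.obj X)] :
    IsNoetherian Sᵐᵒᵖ X := by
  let j (V : Submodule Sᵐᵒᵖ X) : ModuleCat.of Sᵐᵒᵖ V ⟶ X := ModuleCat.ofHom V.subtype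
  let φ (V : Submodule Sᵐᵒᵖ X) : Submodule Rᵐᵒᵖ (c.e.obj X) := LinearMap.range (c.e.map (j V)).hom
  have hj (V) : Mono (j V) := (ModuleCat.mono_iff_injective _).2 V.injective_subtype
  have hφ : StrictMono φ := by
    intro V W hVW
    let k : ModuleCat.of Sᵐᵒᵖ V ⟶ ModuleCat.of Sᵐᵒᵖ W :=
      ModuleCat.ofHom (Submodule.inclusion hVW.le)
    have hk : j V = k ≫ j W := rfl
    have h1 (x) : (c.e.map (j V)).hom x = (c.e.map (j W)).hom ((c.e.map k).hom x) := by
      rw [hk, Functor.map_comp]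
      rfl
    refine lt_of_le_of_ne ?_ fun heq => hVW.not_ge ?_
    · rintro _ ⟨x, rfl⟩
      exact ⟨_, (h1 x).symm⟩
    · have : Epi (c.e.map k) := by
        rw [ModuleCat.epi_iff_surjective]
        intro y
        obtain ⟨x, hx⟩ : (c.e.map (j W)).hom y ∈ φ V := heq ▸ ⟨y, rfl⟩
        refine ⟨x, (ModuleCat.mono_iff_injective (c.e.map (j W))).1 inferInstance ?_⟩
        exact (h1 x).symm.trans hx
      have := (ModuleCat.epi_iff_surjective k).1 (c.e.epi_of_epi_map this)
      intro w hw
      obtain ⟨v, hv⟩ := this ⟨w, hw⟩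
      have : (v : X) = w := congrArg Subtype.val hv
      exact this ▸ v.2
  rw [isNoetherian_iff']
  have := isNoetherian_iff'.1 h
  exact hφ.wellFoundedGT

/-- As `e (i X) ≅ X` is Noetherian, `i X` is finitely generated. Lift a finite free cover of `i X`
along `δ : l X ⟶ i X`. Maps from `l X` to the image of `i` factor through `δ`, so the cokernel of
the lift has no nonzero map to that image, and Nakayama makes it zero. -/
lemma finite_l [IsNoetherianRing Rᵐᵒᵖ] (hn : IsNilpotentEndofunctor c.F) (X : RightMod R)
    [Module.Finite Rᵐᵒᵖ X] : Module.Finite Sᵐᵒᵖ (c.l.obj X) := by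
  have : IsNoetherian Rᵐᵒᵖ (c.e.obj (c.i.obj X)) :=
    isNoetherian_of_linearEquiv (c.θ X).symm.toLinearEquiv
  have := c.isNoetherian_of_e (c.i.obj X)
  obtain ⟨n, p, hp⟩ := Module.Finite.exists_fin' Sᵐᵒᵖ (c.i.obj X)
  let L : RightMod S := ModuleCat.of Sᵐᵒᵖ (Fin n → Sᵐᵒᵖ)
  let π : L ⟶ c.i.obj X := ModuleCat.ofHom p
  have hπ : Epi π := (ModuleCat.epi_iff_surjective _).2 hp
  have hL : Projective L := ModuleCat.projective_of_free (Pi.basisFun Sᵐᵒᵖ (Fin n))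
  let s : L ⟶ c.l.obj X := Projective.factorThru π (c.δ X)
  have hs : s ≫ c.δ X = π := Projective.factorThru_comp _ _
  have h : IsZero (cokernel s) := by
    refine c.isZero_of_hom_i_eq_zero hn _ fun Y f => ?_
    obtain ⟨u, hu⟩ := c.exists_δ_comp (cokernel.π s ≫ f)
    have : c.i.map u = 0 := by
      rw [← cancel_epi π, ← hs, Category.assoc, hu, cokernel.condition_assoc, zero_comp, comp_zero]
    rw [← cancel_epi (cokernel.π s), ← hu, this, comp_zero, comp_zero]
  have : Epi s := Abelian.epi_of_cokernel_π_eq_zero _ (h.eq_of_tgt _ _)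
  exact Module.Finite.of_surjective s.hom ((ModuleCat.epi_iff_surjective s).1 this)

end Modules

end CleftExtension

/-! ### Extension of morphisms from cosyzygies, and statement (i) -/

section

variable {R : Type u} [Ring R]

/-- A linear map from a finitely generated module to a projective module factors through a finitely
generated free module. -/
lemma Module.Projective.exists_factorization {M N : Type*} [AddCommGroup M] [AddCommGroup N]
    [Module R M] [Module R N] [Module.Finite R M] [Module.Projective R N] (a : M →ₗ[R] N) :
    ∃ (n : ℕ) (b : M →ₗ[R] (Fin n → R)) (d : (Fin n → R) →ₗ[R] N), d ∘ₗ b = a := by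
  classical
  obtain ⟨s, hs⟩ := (Module.projective_def' (R := R) (P := N)).1 inferInstance
  obtain ⟨m, p, hp⟩ := Module.Finite.exists_fin' R M
  -- Only the basis vectors in the supports of the images of finitely many generators are needed.
  let t : Finset N := Finset.univ.biUnion fun k => (s (a (p (Pi.single k 1)))).support
  have ht (x : M) : s (a x) ∈ Finsupp.supported R R (t : Set N) := by
    obtain ⟨y, rfl⟩ := hp x
    rw [pi_eq_sum_univ' y]
    simp only [map_sum, map_smul]
    refine Submodule.sum_mem _ fun k _ => ?_
    refine Submodule.smul_mem _ _ ((Finsupp.mem_supported _ _).2 ?_)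
    exact_mod_cast Finset.subset_biUnion_of_mem
      (fun k => (s (a (p (Pi.single k 1)))).support) (Finset.mem_univ k)
  let e : (t →₀ R) ≃ₗ[R] (Fin t.card → R) :=
    Finsupp.domLCongr t.equivFin ≪≫ₗ Finsupp.linearEquivFunOnFinite R R (Fin t.card)
  let v : t → N := Subtype.val
  refine ⟨t.card, e.toLinearMap ∘ₗ Finsupp.lcomapDomain v Subtype.val_injective ∘ₗ s ∘ₗ a,
    Finsupp.linearCombination R v ∘ₗ e.symm.toLinearMap, ?_⟩
  ext x
  have h : Finsupp.mapDomain v (Finsupp.comapDomain v (s (a x)) Subtype.val_injective.injOn) =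
      s (a x) := by
    refine Finsupp.mapDomain_comapDomain v Subtype.val_injective _ ?_
    rw [Subtype.range_coe]
    exact (Finsupp.mem_supported _ _).1 (ht x)
  have h' : Finsupp.linearCombination R id (s (a x)) = a x := LinearMap.congr_fun hs (a x)
  rw [← h, Finsupp.linearCombination_mapDomain] at h'
  simpa using h'

end

namespace CategoryTheory

/-- If all morphisms from the cosyzygies `Z k` to projective objects extend to `P k`, then so do the
morphisms to objects of finite projective dimension. -/
lemma HasFiniteProjectiveDimension.exists_extension {C : Type u} [Category.{v} C] [Abelian C]
    [EnoughProjectives C] {Z P : ℤ → C} {f : ∀ k, Z k ⟶ P k} {g : ∀ k, P k ⟶ Z (k + 1)}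
    {w : ∀ k, f k ≫ g k = 0} (hS : ∀ k, (ShortComplex.mk (f k) (g k) (w k)).ShortExact)
    (hP : ∀ k, Projective (P k))
    (hext : ∀ Q : C, Projective Q → ∀ (k : ℤ) (a : Z k ⟶ Q), ∃ b : P k ⟶ Q, f k ≫ b = a)
    {M : C} (hM : HasFiniteProjectiveDimension M) (k : ℤ) (a : Z k ⟶ M) :
    ∃ b : P k ⟶ M, f k ≫ b = a := by
  suffices ∀ (m : ℕ) (M : C), HasProjectiveDimensionLT M (m + 1) → ∀ (k : ℤ) (a : Z k ⟶ M),
      ∃ b : P k ⟶ M, f k ≫ b = a by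
    obtain ⟨m, hm⟩ := hM
    exact this m M (hasProjectiveDimensionLT_of_ge M m _ (by lia)) k a
  intro m
  induction m with
  | zero => exact fun M hM => hext M (projective_iff_hasProjectiveDimensionLT_one.2 hM)
  | succ m ih =>
    intro M hM k a
    have hπ := ShortComplex.shortExact_kernel (Projective.π M)
    have hK := (hπ.hasProjectiveDimensionLT_X₃_iff m inferInstance).1 hM
    obtain ⟨j, rfl⟩ : ∃ j, k = j + 1 := ⟨k - 1, by lia⟩
    have := (hS j).epi_g
    -- The goal is to lift `a` to the cover of `M`. The lift `c` of `g j ≫ a` may be nonzero on `Z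
    -- j`, but there it lands in the kernel; extending that restriction by induction and subtracting
    -- lets `c` descend to `Z (j + 1)`.
    let c : P j ⟶ Projective.over M := Projective.factorThru (g j ≫ a) (Projective.π M)
    have hc : c ≫ Projective.π M = g j ≫ a := Projective.factorThru_comp _ _
    obtain ⟨d, hd⟩ := ih _ hK j (kernel.lift (Projective.π M) (f j ≫ c) (by
      rw [Category.assoc, hc, reassoc_of% (w j), zero_comp]))
    have h0 : f j ≫ (c - d ≫ kernel.ι _) = 0 := by
      rw [Preadditive.comp_sub, reassoc_of% hd, kernel.lift_ι, sub_self]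
    let b : Z (j + 1) ⟶ Projective.over M := (hS j).gIsCokernel.desc (CokernelCofork.ofπ _ h0)
    have hb : g j ≫ b = c - d ≫ kernel.ι _ := (hS j).gIsCokernel.fac (CokernelCofork.ofπ _ h0)
      WalkingParallelPair.one
    have hba : b ≫ Projective.π M = a := by
      rw [← cancel_epi (g j), reassoc_of% hb, Preadditive.sub_comp, hc, Category.assoc,
        kernel.condition, comp_zero, sub_zero]
    obtain ⟨b', hb'⟩ := hext _ inferInstance (j + 1) b
    exact ⟨b' ≫ Projective.π M, by rw [reassoc_of% hb', hba]⟩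

end CategoryTheory

section

variable {R : Type u} [Ring R] [IsNoetherianRing Rᵐᵒᵖ]

/-- Passes from finitely generated projectives to arbitrary ones, which occur in the covers used for
`e Q`: a map from the finitely generated `Z k` factors through a finite free module. -/
lemma TotalSyzygies.exists_extension_incl (T : TotalSyzygies (FGRightMod R)) (Q : RightMod R)
    (hQ : Projective Q) (k : ℤ) (a : (FGRightMod.incl R).obj (T.Z k) ⟶ Q) :
    ∃ b : (FGRightMod.incl R).obj (T.P k) ⟶ Q, (FGRightMod.incl R).map (T.f k) ≫ b = a := by
  have : Module.Projective Rᵐᵒᵖ Q := (IsProjective.iff_projective Q).2 hQ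
  have : Module.Finite Rᵐᵒᵖ ((FGRightMod.incl R).obj (T.Z k)) := (T.Z k).property
  obtain ⟨n, b, d, hbd⟩ := Module.Projective.exists_factorization a.hom
  let L : FGRightMod R := FGModuleCat.of Rᵐᵒᵖ (Fin n → Rᵐᵒᵖ)
  have hL : Projective ((FGRightMod.incl R).obj L) :=
    ModuleCat.projective_of_free (Pi.basisFun Rᵐᵒᵖ (Fin n))
  let b' : T.Z k ⟶ L := ObjectProperty.homMk (ModuleCat.ofHom b)
  obtain ⟨e, he⟩ := T.extend k L (FGRightMod.projective_of_incl hL) b'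
  refine ⟨(FGRightMod.incl R).map e ≫ ModuleCat.ofHom d, ?_⟩
  rw [← Category.assoc, ← Functor.map_comp, he]
  exact ModuleCat.hom_ext hbd

variable {S : Type u} [Ring S] [IsNoetherianRing Sᵐᵒᵖ]

namespace CleftExtension

variable (c : CleftExtension (RightMod R) (RightMod S))

/-- The functor between categories of finitely generated modules which is induced by `l`. -/
def lFG (hn : IsNilpotentEndofunctor c.F) : FGRightMod R ⥤ FGRightMod S :=
  ObjectProperty.lift _ (FGRightMod.incl R ⋙ c.l) (fun X => by
    have : Module.Finite Rᵐᵒᵖ ((FGRightMod.incl R).obj X) := X.property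
    exact c.finite_l hn _)

/-- The functor `l` preserves the syzygies of totally acyclic complexes. -/
def mapTotalSyzygies (hc : IsPerfectEndofunctor c.F) (hn : IsNilpotentEndofunctor c.F)
    (T : TotalSyzygies (FGRightMod R)) : TotalSyzygies (FGRightMod S) where
  Z k := (c.lFG hn).obj (T.Z k)
  P k := (c.lFG hn).obj (T.P k)
  f k := (c.lFG hn).map (T.f k)
  g k := (c.lFG hn).map (T.g k)
  w k := by
    apply (FGRightMod.incl S).map_injective
    change c.l.map ((FGRightMod.incl R).map (T.f k)) ≫ c.l.map ((FGRightMod.incl R).map (T.g k)) = 0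
    rw [← Functor.map_comp, ← Functor.map_comp, T.w, Functor.map_zero, Functor.map_zero]
  shortExact k := by
    have hS k := (T.shortExact k).map_of_exact (FGRightMod.incl R)
    -- The vanishing of `𝕃₁F` on `Z (k + 1)` makes `F`, and hence `l`, preserve the monomorphism
    -- `T.f k`.
    have hT : SyzygyFlat (endofunctorPow c.F 1) 0 ((FGRightMod.incl R).obj (T.Z (k + 1))) :=
      c.syzygyFlat_cosyzygies hc (Z := fun k => (FGRightMod.incl R).obj (T.Z k))
        (P := fun k => (FGRightMod.incl R).obj (T.P k)) hS 1 (fun n k => by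
          have := T.projective k
          have := FGRightMod.projective_incl (T.P k)
          exact .of_isZero_leftDerived _ _
            (Functor.isZero_leftDerived_obj_projective_succ _ n _)) 0 (k + 1)
    have : Mono ((FGRightMod.incl R).map (T.f k)) := (hS k).mono_f
    have : Mono (c.F.map ((FGRightMod.incl R).map (T.f k))) := hT.mono_map (hS k)
    obtain ⟨he, hepi⟩ := c.l.map_exact_and_epi _ ⟨(hS k).exact, (hS k).epi_g⟩
    refine ShortComplex.ShortExact.mk' ?_ ?_ ?_
    · rw [← ShortComplex.exact_map_iff_of_faithful _ (FGRightMod.incl S)]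
      exact he
    · exact (FGRightMod.incl S).mono_of_mono_map
        (c.mono_l_map ((FGRightMod.incl R).map (T.f k)))
    · exact (FGRightMod.incl S).epi_of_epi_map hepi
  projective k := by
    have := T.projective k
    have := FGRightMod.projective_incl (T.P k)
    exact FGRightMod.projective_of_incl (c.projective_l ((FGRightMod.incl R).obj (T.P k)))
  extend k Q hQ a := by
    have := FGRightMod.projective_incl Q
    -- By adjunction, extending `a` to `l (P k)` means extending its transpose `Z k ⟶ e Q` to `P k`,
    -- possible since `e Q` has finite projective dimension.
    obtain ⟨b, hb⟩ := (c.hasFiniteProjectiveDimension_e hc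
      ((FGRightMod.incl S).obj Q)).exists_extension
      (Z := fun k => (FGRightMod.incl R).obj (T.Z k))
      (P := fun k => (FGRightMod.incl R).obj (T.P k))
      (fun k => (T.shortExact k).map_of_exact (FGRightMod.incl R))
      (fun k => by
        have := T.projective k
        exact FGRightMod.projective_incl (T.P k)) T.exists_extension_incl k
      (c.adj.homEquiv _ _ ((FGRightMod.incl S).map a))
    refine ⟨ObjectProperty.homMk ((c.adj.homEquiv _ _).symm b), ?_⟩
    apply (FGRightMod.incl S).map_injective
    apply (c.adj.homEquiv _ _).injective
    rw [← hb]
    exact (c.adj.homEquiv_naturality_left _ _).trans (congrArg _ (Equiv.apply_symm_apply _ b))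

end CleftExtension

theorem IsCMFree.of_cleftExtension (c : CleftExtension (RightMod R) (RightMod S))
    (hperf : IsPerfectEndofunctor c.F) (hnil : IsNilpotentEndofunctor c.F) (hS : IsCMFree S) :
    IsCMFree R := by
  refine fun X => ⟨fun hX => ?_, fun _ => gorensteinProjective_of_projective X⟩
  obtain ⟨T, ⟨φ⟩⟩ := (gorensteinProjective_iff X).1 hX
  have : Projective ((c.lFG hnil).obj (T.Z 0)) :=
    (hS _).1 (c.mapTotalSyzygies hperf hnil T).gorensteinProjective_Z
  have h : Projective (c.l.obj ((FGRightMod.incl R).obj (T.Z 0))) :=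
    FGRightMod.projective_incl ((c.lFG hnil).obj (T.Z 0))
  have := FGRightMod.projective_of_incl (c.projective_of_l _ h)
  exact .of_iso φ.symm this

end

end

theorem mainTheorem11 {Γ Λ : Type u} [Ring Γ] [Ring Λ]
    [IsNoetherianRing Γ] [IsNoetherianRing Γᵐᵒᵖ] [IsNoetherianRing Λ] [IsNoetherianRing Λᵐᵒᵖ]
    (c : CleftExtension (RightMod Γ) (RightMod Λ))
    (hperf : IsPerfectEndofunctor c.F) (hnil : IsNilpotentEndofunctor c.F) :
    (IsCMFree Λ → IsCMFree Γ) ∧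
      (InducesStableFunctor c.e → IsCMFree Γ → IsCMFree Λ) :=
  ⟨IsCMFree.of_cleftExtension c hperf hnil, IsCMFree.of_inducesStableFunctor c hperf hnil⟩
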